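/- Let $N\ge 1$ and $m\ge 0$ be integers, $\sigma\in(0,1]$, $s=m+\sigma$, and $\mathbb{R}^N_+=\{x\in\mathbb{R}^N : x_1>0\}$. For $\beta\in\mathbb{R}$ let $(x_1)_+^{\beta}=x_1^{\beta}$ if $x_1>0$ and $(x_1)_+^{\beta}=0$ if $x_1\le 0$. Let $\mathcal{L}^1_s$ be the set of $u\in L^1_{loc}(\mathbb{R}^N)$ with $\int_{\mathbb{R}^N}\frac{|u(x)|}{1+|x|^{N+2s}}\,dx<\infty$. The operator $(-\Delta)^s$ is the iterated Laplacian $(-\Delta)^{m+1}$ if $\sigma=1$ and, if $\sigma\in(0,1)$, $$(-\Delta)^s u(x)=\frac{c_{N,s}}{2}\int_{\mathbb{R}^N}\frac{\sum_{j=-m-1}^{m+1}(-1)^j\binom{2m+2}{m+1-j}u(x+jy)}{|y|^{N+2s}}\,dy,\qquad c_{N,s}=\frac{4^s\,\Gamma(\frac N2+s)}{\pi^{N/2}\,\Gamma(-s)}\Big(\sum_{j=1}^{m+1}(-1)^j\binom{2m+2}{m+1-j}j^{2s}\Big)^{-1}.$$ Then, for every $k\in\{0,\ldots,2m+1\}$,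 the function $u(x)=(x_1)_+^{k+\sigma-1}$ is $s$-harmonic in $\mathbb{R}^N_+$. That is, $u\in\mathcal{L}^1_s$, $u\in C^\infty(\mathbb{R}^N_+)$, and $u$ is $s$-harmonic both 1. pointwise: for every $x\in\mathbb{R}^N_+$ one has $(-\Delta)^s u(x)=0$ (where for $\sigma\in(0,1)$ the integral defining $(-\Delta)^s u(x)$ converges absolutely), and 2. in the sense of distributions: for every $\varphi\in C_c^\infty(\mathbb{R}^N_+)$ the function $u\,(-\Delta)^s\varphi$ is integrable on $\mathbb{R}^N$ and $\int_{\mathbb{R}^N}u(x)\,(-\Delta)^s\varphi(x)\,dx=0$. -/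

import Mathlib

open MeasureTheory
open scoped ContDiff

noncomputable section

/-- The open half-space `{x ∈ ℝ^N : x₁ > 0}`; the first coordinate is `x 0`. -/
def halfSpace (N : ℕ) [NeZero N] : Set (EuclideanSpace ℝ (Fin N)) :=
  {x | 0 < x 0}

/-- The function `x ↦ (x₁)₊^a`: it is `x₁^a` where `x₁ > 0` and `0` where `x₁ ≤ 0`,
also for `a ≤ 0`. -/
def posPartPow (N : ℕ) [NeZero N] (a : ℝ) (x : EuclideanSpace ℝ (Fin N)) : ℝ :=
  if 0 < x 0 then (x 0) ^ a else 0

/-- The weighted space `𝓛¹_s(ℝ^N)` of locally integrable functions `u` with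
`∫ |u(x)| / (1 + |x|^(N+2s)) dx < ∞`. -/
def MemWeightedL1 {N : ℕ} (s : ℝ) (u : EuclideanSpace ℝ (Fin N) → ℝ) : Prop :=
  LocallyIntegrable u volume ∧
    Integrable (fun x => |u x| / (1 + ‖x‖ ^ ((N : ℝ) + 2 * s))) volume

/-- The normalization constant `c_{N,s}` for `s = m + σ`, `σ ∈ (0,1)`. -/
def fracLaplacianConst (N m : ℕ) (σ : ℝ) : ℝ :=
  (4 : ℝ) ^ ((m : ℝ) + σ) * Real.Gamma ((N : ℝ) / 2 + ((m : ℝ) + σ)) /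
      (Real.pi ^ ((N : ℝ) / 2) * Real.Gamma (-((m : ℝ) + σ))) *
    (∑ k ∈ Finset.Icc 1 (m + 1),
      (-1 : ℝ) ^ k * ((2 * m + 2).choose (m + 1 - k) : ℝ) * (k : ℝ) ^ (2 * ((m : ℝ) + σ)))⁻¹

/-- The centered finite difference of order `2m + 2`,
`∑_{k=-m-1}^{m+1} (-1)^k binom(2m+2, m+1-k) u(x + k y)`. -/
def centeredDiff {N : ℕ} (m : ℕ) (u : EuclideanSpace ℝ (Fin N) → ℝ)
    (x y : EuclideanSpace ℝ (Fin N)) : ℝ :=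
  ∑ k ∈ Finset.Icc (-((m : ℤ) + 1)) ((m : ℤ) + 1),
    (-1 : ℝ) ^ k * ((2 * m + 2).choose ((m : ℤ) + 1 - k).toNat : ℝ) * u (x + (k : ℝ) • y)

/-- The integrand `y ↦ centeredDiff m u x y / |y|^(N+2s)`, `s = m + σ`. -/
def fracLaplacianIntegrand {N : ℕ} (m : ℕ) (σ : ℝ) (u : EuclideanSpace ℝ (Fin N) → ℝ)
    (x y : EuclideanSpace ℝ (Fin N)) : ℝ :=
  centeredDiff m u x y / ‖y‖ ^ ((N : ℝ) + 2 * ((m : ℝ) + σ))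

/-- The operator `(-Δ)^s` for `s = m + σ`, `m ∈ ℕ`, `σ ∈ (0,1]`, evaluated pointwise: the iterated
Laplacian `(-Δ)^(m+1)` if `σ = 1`, the finite-difference integral if `σ ∈ (0,1)`. -/
def fracLaplacian {N : ℕ} (m : ℕ) (σ : ℝ) (u : EuclideanSpace ℝ (Fin N) → ℝ)
    (x : EuclideanSpace ℝ (Fin N)) : ℝ :=
  if σ = 1 then
    (fun v : EuclideanSpace ℝ (Fin N) → ℝ => fun z => -Laplacian.laplacian v z)^[m + 1] u x
  else
    fracLaplacianConst N m σ / 2 * ∫ y, fracLaplacianIntegrand m σ u x y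

/-- `(-Δ)^s u(x)` is meaningful: `u` is `2m+2` times continuously differentiable near `x` if
`σ = 1`, and the defining integral converges absolutely if `σ ∈ (0,1)`. -/
def FracLaplacianExistsAt {N : ℕ} (m : ℕ) (σ : ℝ) (u : EuclideanSpace ℝ (Fin N) → ℝ)
    (x : EuclideanSpace ℝ (Fin N)) : Prop :=
  (σ = 1 → ContDiffAt ℝ ((2 * m + 2 : ℕ) : WithTop ℕ∞) u x) ∧
    (σ ≠ 1 → Integrable (fracLaplacianIntegrand m σ u x) volume)

/-- `u` is pointwise `s`-harmonic in `U`, `s = m + σ`: `u ∈ 𝓛¹_s` and `(-Δ)^s u(x)` exists and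
vanishes for every `x ∈ U`. -/
def IsPointwiseSHarmonicOn {N : ℕ} (m : ℕ) (σ : ℝ) (u : EuclideanSpace ℝ (Fin N) → ℝ)
    (U : Set (EuclideanSpace ℝ (Fin N))) : Prop :=
  MemWeightedL1 ((m : ℝ) + σ) u ∧
    ∀ x ∈ U, FracLaplacianExistsAt m σ u x ∧ fracLaplacian m σ u x = 0

/-- `u` is `s`-harmonic in `U` in the sense of distributions, `s = m + σ`: `u ∈ 𝓛¹_s` and
`∫ u (-Δ)^s φ = 0` for every `φ ∈ C_c^∞(U)`. -/
def IsDistributionallySHarmonicOn {N : ℕ} (m : ℕ) (σ : ℝ) (u : EuclideanSpace ℝ (Fin N) → ℝ)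
    (U : Set (EuclideanSpace ℝ (Fin N))) : Prop :=
  MemWeightedL1 ((m : ℝ) + σ) u ∧
    ∀ φ : EuclideanSpace ℝ (Fin N) → ℝ,
      ContDiff ℝ ∞ φ → HasCompactSupport φ → tsupport φ ⊆ U →
        Integrable (fun x => u x * fracLaplacian m σ φ x) volume ∧
          ∫ x, u x * fracLaplacian m σ φ x = 0

end

open Set Filter Topology

/-! For σ < 1 the problem is one-dimensional. At a point x of the half-space, homogeneity of the
truncated power turns the centered difference of u into x₁^a D(|y₁|/x₁), where D(y) = ∑ c_j (1 + j
y)₊^a, a = k + σ - 1, and c_j are the difference coefficients. Integrating |y|^(-N-2s) over the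
remaining coordinates leaves a constant times |y₁|^(-1-2s) (`integral_comp_zero_div_norm_rpow`).
Pointwise harmonicity is thus the identity ∫₀^∞ D(y) y^(-1-2s) dy = 0
(`integral_dilationSum_eq_zero`).

For k = 2m+1, integrate by parts 2m+1 times (`mul_integral_dilationSum`). Each step lowers both
exponents by one and replaces c_j by j c_j; the vanishing moments of c kill the boundary term at 0,
and a < 2s kills the one at infinity. What remains has exponents σ - 1 and -2σ and coefficients
j^(2m+1) c_j, which are odd in j. It splits into multiples of dilates of (1+y)^(σ-1) - (1-y)₊^(σ-1),
whose integral against y^(-2σ) is zero because y = t/(1-t) carries one term into the other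
(`integral_symmetricKernel`). For smaller k, the same integration by parts combined with j y = (1 +
j y) - 1 relates the exponents a and a - 1 with c and the kernel unchanged
(`sub_mul_integral_dilationSum`), so the vanishing descends in k.

The distributional statement follows from the pointwise one by moving the operator from φ to u
(`integral_mul_fracLaplacianIntegrand_comm`): Fubini, translation in x, and evenness of c_j. The
double integrals converge because the differences are O(|y|^(2m+2)) near y = 0 and u lies in the
weighted space.

For σ = 1, u agrees on the half-space with the polynomial x₁^k, of degree below 2(m+1), which m+1
Laplacians annihilate; Green's identity gives the weak form. -/

/-! ### Truncated powers and sums of their dilates -/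

/-- The one-dimensional truncated power `t₊^a`, equal to `0` for `t ≤ 0`. -/
noncomputable def posRpow (a t : ℝ) : ℝ := if 0 < t then t ^ a else 0

/-- The combination `∑_{j ∈ J} c_j (1 + j y)₊^a` of dilated truncated powers. -/
noncomputable def dilationSum (J : Finset ℤ) (c : ℤ → ℝ) (a y : ℝ) : ℝ :=
  ∑ j ∈ J, c j * posRpow a (1 + j * y)

lemma posRpow_of_pos {a t : ℝ} (ht : 0 < t) : posRpow a t = t ^ a := if_pos ht

lemma posRpow_of_nonpos {a t : ℝ} (ht : t ≤ 0) : posRpow a t = 0 := if_neg ht.not_gt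

lemma posRpow_nonneg (a t : ℝ) : 0 ≤ posRpow a t := by
  unfold posRpow; split_ifs with h
  · positivity
  · exact le_rfl

lemma posRpow_mul {a r : ℝ} (hr : 0 < r) (t : ℝ) : posRpow a (r * t) = r ^ a * posRpow a t := by
  rcases lt_or_ge 0 t with h | h
  · rw [posRpow_of_pos h, posRpow_of_pos (by positivity), Real.mul_rpow hr.le h.le]
  · rw [posRpow_of_nonpos h, posRpow_of_nonpos (mul_nonpos_of_nonneg_of_nonpos hr.le h), mul_zero]

lemma measurable_posRpow (a : ℝ) : Measurable (posRpow a) :=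
  Measurable.ite measurableSet_Ioi (by fun_prop) measurable_const

lemma posRpow_eq_max_rpow {a : ℝ} (ha : a ≠ 0) : posRpow a = fun t => (max t 0) ^ a := by
  ext t
  rcases lt_or_ge 0 t with h | h
  · rw [posRpow_of_pos h, max_eq_left h.le]
  · rw [posRpow_of_nonpos h, max_eq_right h, Real.zero_rpow ha]

lemma continuous_posRpow {a : ℝ} (ha : 0 < a) : Continuous (posRpow a) := by
  rw [posRpow_eq_max_rpow ha.ne']
  exact (continuous_id.max continuous_const).rpow_const fun _ => Or.inr ha.le

lemma hasDerivAt_posRpow {t : ℝ} (a : ℝ) (ht : t ≠ 0) :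
    HasDerivAt (posRpow a) (a * posRpow (a - 1) t) t := by
  rcases ht.lt_or_gt with h | h
  · rw [posRpow_of_nonpos h.le, mul_zero]
    refine (hasDerivAt_const t (0 : ℝ)).congr_of_eventuallyEq ?_
    filter_upwards [Iio_mem_nhds h] with z hz
    exact posRpow_of_nonpos (le_of_lt hz)
  · rw [posRpow_of_pos h]
    refine (Real.hasDerivAt_rpow_const (Or.inl h.ne')).congr_of_eventuallyEq ?_
    filter_upwards [Ioi_mem_nhds h] with z hz
    exact posRpow_of_pos hz

lemma measurable_dilationSum (J : Finset ℤ) (c : ℤ → ℝ) (a : ℝ) :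
    Measurable (dilationSum J c a) :=
  Finset.measurable_sum _ fun _ _ =>
    ((measurable_posRpow a).comp (by fun_prop)).const_mul _

lemma continuous_dilationSum (J : Finset ℤ) (c : ℤ → ℝ) {a : ℝ} (ha : 0 < a) :
    Continuous (dilationSum J c a) :=
  continuous_finsetSum _ fun _ _ =>
    ((continuous_posRpow ha).comp (by fun_prop)).const_mul _

lemma hasDerivAt_dilationSum (J : Finset ℤ) (c : ℤ → ℝ) (a : ℝ) {y : ℝ}
    (hy : ∀ j ∈ J, 1 + (j : ℝ) * y ≠ 0) :
    HasDerivAt (dilationSum J c a) (a * dilationSum J (fun j => j * c j) (a - 1) y) y := by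
  have : HasDerivAt (fun y => ∑ j ∈ J, c j * posRpow a (1 + j * y))
      (∑ j ∈ J, c j * (a * posRpow (a - 1) (1 + j * y) * (j * 1))) y := by
    refine HasDerivAt.fun_sum fun j hj => ?_
    exact ((hasDerivAt_posRpow a (hy j hj)).comp y
      (((hasDerivAt_id y).const_mul (j : ℝ)).const_add 1)).const_mul _
  refine this.congr_deriv ?_
  rw [dilationSum, Finset.mul_sum]
  exact Finset.sum_congr rfl fun j _ => by ring

lemma dilationSum_zero (J : Finset ℤ) (c : ℤ → ℝ) (a : ℝ) :
    dilationSum J c a 0 = ∑ j ∈ J, c j := by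
  simp [dilationSum, posRpow]

/-- Since j y = (1 + j y) - 1, the weight j produced by differentiation can be traded for a change
of exponent. -/
lemma mul_dilationSum (J : Finset ℤ) (c : ℤ → ℝ) (a y : ℝ) :
    y * dilationSum J (fun j => j * c j) (a - 1) y
      = dilationSum J c a y - dilationSum J c (a - 1) y := by
  simp only [dilationSum, Finset.mul_sum]
  rw [← Finset.sum_sub_distrib]
  refine Finset.sum_congr rfl fun j _ => ?_
  rcases lt_or_ge 0 (1 + j * y) with h | h
  · rw [posRpow_of_pos h, posRpow_of_pos h]
    have : (1 + j * y) ^ a = (1 + j * y) ^ (a - 1) * (1 + j * y) := by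
      rw [Real.rpow_sub_one h.ne', div_mul_cancel₀ _ h.ne']
    rw [this]; ring
  · simp [posRpow_of_nonpos h]

/-! ### Behaviour at zero and integrability on the half-line -/

/-- For 0 ≤ y ≤ r every 1 + j y stays away from 0, so no truncation is felt there. -/
lemma exists_radius (J : Finset ℤ) : ∃ r : ℝ, 0 < r ∧ ∀ j ∈ J, |(j : ℝ)| * r ≤ 1 / 2 := by
  set M : ℝ := ∑ j ∈ J, |(j : ℝ)|
  have hM : 0 ≤ M := Finset.sum_nonneg fun _ _ => abs_nonneg _
  refine ⟨1 / (2 * (M + 1)), by positivity, fun j hj => ?_⟩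
  have h : |(j : ℝ)| ≤ M := Finset.single_le_sum (f := fun j : ℤ => |(j : ℝ)|)
    (fun _ _ => abs_nonneg _) hj
  rw [mul_one_div, div_le_div_iff₀ (by positivity) (by norm_num)]
  linarith

/-- If the first `Q` moments of `c` vanish, `∑ c_j (1 + j y)₊^a = O(y^Q)` at `0`. -/
lemma exists_abs_dilationSum_le {J : Finset ℤ} {r : ℝ}
    (hr : ∀ j ∈ J, |(j : ℝ)| * r ≤ 1 / 2) (Q : ℕ) (c : ℤ → ℝ) (a : ℝ)
    (hc : ∀ q < Q, ∑ j ∈ J, c j * (j : ℝ) ^ q = 0) :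
    ∃ C, 0 ≤ C ∧ ∀ y ∈ Icc 0 r, |dilationSum J c a y| ≤ C * y ^ Q := by
  have key : ∀ j ∈ J, ∀ y ∈ Icc 0 r, 1 + (j : ℝ) * y ∈ Icc (1 / 2 : ℝ) 2 := by
    intro j hj y hy
    have h1 : |(j : ℝ) * y| ≤ 1 / 2 := by
      rw [abs_mul, abs_of_nonneg hy.1]
      exact (mul_le_mul_of_nonneg_left hy.2 (abs_nonneg _)).trans (hr j hj)
    have := abs_le.1 h1
    constructor <;> linarith
  induction Q generalizing c a with
  | zero =>
    have hcont : ContinuousOn (fun t : ℝ => t ^ a) (Icc (1 / 2) 2) :=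
      ContinuousOn.rpow_const continuousOn_id fun t ht => Or.inl
        (lt_of_lt_of_le (by norm_num) ht.1).ne'
    obtain ⟨B, hB⟩ := isCompact_Icc.exists_bound_of_continuousOn hcont
    have hB0 : 0 ≤ B := (norm_nonneg _).trans (hB 1 (by norm_num))
    refine ⟨∑ j ∈ J, |c j| * B, Finset.sum_nonneg fun _ _ => by positivity, fun y hy => ?_⟩
    rw [pow_zero, mul_one]
    refine (Finset.abs_sum_le_sum_abs _ _).trans (Finset.sum_le_sum fun j hj => ?_)
    have h := key j hj y hy
    rw [abs_mul, posRpow_of_pos (by linarith [h.1])]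
    exact mul_le_mul_of_nonneg_left (hB _ h) (abs_nonneg _)
  | succ Q ih =>
    -- The derivative has coefficients j c_j, whose moments are those of c shifted by one;
    -- integrating its bound gains one power of y.
    obtain ⟨C, hC, h⟩ := ih (fun j => j * c j) (a - 1) fun q hq => by
      rw [← hc (q + 1) (by omega)]
      exact Finset.sum_congr rfl fun j _ => by ring
    refine ⟨|a| * C, by positivity, fun y hy => ?_⟩
    have hd : ∀ x ∈ Icc 0 y, HasDerivWithinAt (dilationSum J c a)
        (a * dilationSum J (fun j => j * c j) (a - 1) x) (Icc 0 y) x := fun x hx =>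
      (hasDerivAt_dilationSum J c a fun j hj => by
        have := (key j hj x ⟨hx.1, hx.2.trans hy.2⟩).1
        linarith).hasDerivWithinAt
    have hb : ∀ x ∈ Ico 0 y, ‖a * dilationSum J (fun j => j * c j) (a - 1) x‖
        ≤ |a| * C * y ^ Q := fun x hx => by
      rw [norm_mul, Real.norm_eq_abs, Real.norm_eq_abs, mul_assoc]
      refine mul_le_mul_of_nonneg_left ((h x ⟨hx.1, hx.2.le.trans hy.2⟩).trans ?_) (abs_nonneg _)
      exact mul_le_mul_of_nonneg_left (pow_le_pow_left₀ hx.1 hx.2.le _) hC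
    have := norm_image_sub_le_of_norm_deriv_le_segment' hd hb y ⟨hy.1, le_rfl⟩
    have h0 : dilationSum J c a 0 = 0 := by
      rw [dilationSum_zero, ← hc 0 (by omega)]; simp
    rw [h0, sub_zero, sub_zero, Real.norm_eq_abs] at this
    rw [pow_succ, ← mul_assoc]; exact this

lemma intervalIntegrable_posRpow {a : ℝ} (ha : -1 < a) (b d : ℝ) :
    IntervalIntegrable (posRpow a) volume b d := by
  have h : posRpow a = (Ioi 0).indicator fun t => t ^ a := by
    ext t; simp [posRpow, indicator]
  have := intervalIntegral.intervalIntegrable_rpow' (a := b) (b := d) ha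
  rw [intervalIntegrable_iff] at this ⊢
  rw [h]
  exact this.indicator measurableSet_Ioi

/-- For j < 0 the support in y is bounded and the singularity at y = -1/j is integrable as a > -1;
for j = 0 only y^(-1-p) is left, which needs p > 0; for j > 0 the tail is y^(a-1-p). -/
lemma integrableOn_Ioi_posRpow_mul_rpow {a p r : ℝ} (j : ℤ) (ha : -1 < a) (hap : a < p)
    (hp : 0 < p ∨ j ≠ 0) (hr : 0 < r) :
    IntegrableOn (fun y : ℝ => posRpow a (1 + j * y) * y ^ (-1 - p)) (Ioi r) := by
  have hmeas : Measurable fun y : ℝ => posRpow a (1 + j * y) * y ^ (-1 - p) :=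
    ((measurable_posRpow a).comp (by fun_prop)).mul (by fun_prop)
  rcases lt_trichotomy j 0 with hj | hj | hj
  · have hj' : (j : ℝ) ≤ -1 := by exact_mod_cast (by omega : j ≤ -1)
    have hsplit : Ioi r = Ioc r (r + 1) ∪ Ioi (r + 1) :=
      (Ioc_union_Ioi_eq_Ioi (by linarith)).symm
    rw [hsplit]
    refine IntegrableOn.union ?_ ?_
    · have h1 : IntervalIntegrable (fun y : ℝ => posRpow a (1 + j * y)) volume r (r + 1) := by
        have h2 := (intervalIntegrable_posRpow ha (1 + j * r) (1 + j * (r + 1))).comp_add_left 1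
        have h3 := h2.comp_mul_left (c := (j : ℝ))
        have hj0 : (j : ℝ) ≠ 0 := by linarith
        convert h3 using 1 <;> field_simp <;> ring
      have h4 := h1.mul_continuousOn (g := fun y : ℝ => y ^ (-1 - p)) (by
        refine ContinuousOn.rpow_const continuousOn_id fun t ht => Or.inl ?_
        rw [uIcc_of_le (by linarith)] at ht
        exact (hr.trans_le ht.1).ne')
      exact (intervalIntegrable_iff_integrableOn_Ioc_of_le (by linarith)).1 h4
    · refine integrableOn_zero.congr_fun (fun y hy => ?_) measurableSet_Ioi
      have hy : r + 1 < y := hy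
      simp only
      rw [posRpow_of_nonpos (by nlinarith), zero_mul]
  · subst hj
    have hp : 0 < p := by simpa using hp
    simpa [posRpow] using integrableOn_Ioi_rpow_of_lt (a := -1 - p) (by linarith) hr
  · have hj' : (0 : ℝ) < j := by exact_mod_cast hj
    -- As y⁻¹ + j lies between j and r⁻¹ + j, the sum of the two powers bounds (y⁻¹ + j)^a for
    -- either sign of a.
    have hI : IntegrableOn (fun y : ℝ => ((j : ℝ) ^ a + (r⁻¹ + j) ^ a) * y ^ (a - 1 - p)) (Ioi r) :=
      (integrableOn_Ioi_rpow_of_lt (by linarith) hr).const_mul _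
    refine hI.mono' hmeas.aestronglyMeasurable ?_
    refine (ae_restrict_iff' measurableSet_Ioi).2 (Eventually.of_forall fun y hy => ?_)
    have hy : r < y := hy
    have hy0 : 0 < y := hr.trans hy
    rw [posRpow_of_pos (by positivity), Real.norm_of_nonneg (by positivity)]
    have e1 : (1 + (j : ℝ) * y) = (y⁻¹ + j) * y := by field_simp
    have e2 : y ^ (a - 1 - p) = y ^ a * y ^ (-1 - p) := by
      rw [← Real.rpow_add hy0]; congr 1; ring
    rw [e1, Real.mul_rpow (by positivity) hy0.le, e2, ← mul_assoc]
    gcongr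
    rcases le_total 0 a with h | h
    · have : (y⁻¹ + j) ^ a ≤ (r⁻¹ + j) ^ a :=
        Real.rpow_le_rpow (by positivity) (by gcongr) h
      have : 0 ≤ (j : ℝ) ^ a := by positivity
      linarith
    · have : (y⁻¹ + j) ^ a ≤ (j : ℝ) ^ a :=
        Real.rpow_le_rpow_of_nonpos hj' (by linarith [inv_pos.2 hy0]) h
      have : 0 ≤ (r⁻¹ + j) ^ a := by positivity
      linarith

/-- Vanishing moments give y^(Q-1-p) at 0. The alternative c 0 = 0 removes the constant term, the
only one requiring p > 0 at infinity; it serves for coefficients j c_j, where p may be negative. -/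
lemma integrableOn_Ioi_zero_dilationSum {J : Finset ℤ} {c : ℤ → ℝ} {a p : ℝ} {Q : ℕ}
    (hc : ∀ q < Q, ∑ j ∈ J, c j * (j : ℝ) ^ q = 0) (ha : -1 < a) (hap : a < p) (hpQ : p < Q)
    (hp : 0 < p ∨ c 0 = 0) :
    IntegrableOn (fun y : ℝ => dilationSum J c a y * y ^ (-1 - p)) (Ioi 0) := by
  obtain ⟨r, hr0, hr⟩ := exists_radius J
  obtain ⟨C, hC, hb⟩ := exists_abs_dilationSum_le hr Q c a hc
  rw [← Ioc_union_Ioi_eq_Ioi hr0.le]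
  refine IntegrableOn.union ?_ ?_
  · have hI : IntegrableOn (fun y : ℝ => C * y ^ (Q - 1 - p)) (Ioc 0 r) := by
      have := intervalIntegral.intervalIntegrable_rpow' (a := 0) (b := r) (r := Q - 1 - p)
        (by linarith)
      exact ((intervalIntegrable_iff_integrableOn_Ioc_of_le hr0.le).1 this).const_mul _
    refine hI.mono' ((measurable_dilationSum J c a).mul (by fun_prop)).aestronglyMeasurable ?_
    refine (ae_restrict_iff' measurableSet_Ioc).2 (Eventually.of_forall fun y hy => ?_)
    have e : y ^ (Q - 1 - p) = y ^ Q * y ^ (-1 - p) := by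
      rw [← Real.rpow_natCast, ← Real.rpow_add hy.1]; congr 1; ring
    have hy0 : 0 ≤ y ^ (-1 - p) := Real.rpow_nonneg hy.1.le _
    rw [norm_mul, Real.norm_eq_abs, Real.norm_of_nonneg hy0, e, ← mul_assoc]
    exact mul_le_mul_of_nonneg_right (hb y ⟨hy.1.le, hy.2⟩) hy0
  · simp only [dilationSum, Finset.sum_mul, mul_assoc]
    refine integrable_finsetSum _ fun j _ => ?_
    by_cases hj : c j = 0
    · simp [hj]
    · refine (integrableOn_Ioi_posRpow_mul_rpow j ha hap ?_ hr0).const_mul _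
      exact hp.imp id fun h0 hj0 => hj (hj0 ▸ h0)

/-! ### Integration by parts on the half-line -/

lemma tendsto_posRpow_mul_rpow_atTop {a p : ℝ} (j : ℤ) (ha : 0 ≤ a) (hap : a < p) :
    Tendsto (fun y : ℝ => posRpow a (1 + j * y) * y ^ (-p)) atTop (𝓝 0) := by
  have h := (tendsto_rpow_neg_atTop (sub_pos.2 hap)).const_mul ((1 + |(j : ℝ)|) ^ a)
  rw [mul_zero] at h
  refine squeeze_zero' ?_ ?_ h
  · filter_upwards [eventually_gt_atTop 0] with y hy
    exact mul_nonneg (posRpow_nonneg _ _) (Real.rpow_nonneg hy.le _)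
  · filter_upwards [eventually_ge_atTop 1] with y hy
    have hy0 : 0 < y := by linarith
    have e : y ^ (-(p - a)) = y ^ a * y ^ (-p) := by
      rw [← Real.rpow_add hy0]; congr 1; ring
    rw [e, ← mul_assoc, ← Real.mul_rpow (by positivity) hy0.le]
    gcongr
    rcases lt_or_ge 0 (1 + j * y) with h | h
    · rw [posRpow_of_pos h]
      refine Real.rpow_le_rpow h.le ?_ ha
      have := mul_le_mul_of_nonneg_right (le_abs_self (j : ℝ)) hy0.le
      nlinarith
    · rw [posRpow_of_nonpos h]; positivity

/-- Integration by parts for `∑ c_j (1 + j y)₊^a` against `y^(-1-p)` on `(0, ∞)`. -/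
lemma mul_integral_dilationSum {J : Finset ℤ} {c : ℤ → ℝ} {a p : ℝ} {Q : ℕ}
    (hc : ∀ q < Q, ∑ j ∈ J, c j * (j : ℝ) ^ q = 0) (ha : 0 < a) (hap : a < p) (hpQ : p < Q) :
    p * ∫ y in Ioi (0 : ℝ), dilationSum J c a y * y ^ (-1 - p)
      = a * ∫ y in Ioi (0 : ℝ), dilationSum J (fun j => j * c j) (a - 1) y * y ^ (-1 - (p - 1)) := by
  have hp : 0 < p := ha.trans hap
  have hQ : 0 < Q := by exact_mod_cast hp.trans hpQ
  obtain ⟨r, hr0, hr⟩ := exists_radius J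
  obtain ⟨C, hC, hb⟩ := exists_abs_dilationSum_le hr Q c a hc
  have hI1 := integrableOn_Ioi_zero_dilationSum hc (by linarith) hap hpQ (Or.inl hp)
  have hI2 : IntegrableOn (fun y : ℝ =>
      dilationSum J (fun j => j * c j) (a - 1) y * y ^ (-1 - (p - 1))) (Ioi 0) := by
    refine integrableOn_Ioi_zero_dilationSum (Q := Q - 1) (fun q hq => ?_) (by linarith)
      (by linarith) ?_ (Or.inr (by simp))
    · rw [← hc (q + 1) (by omega)]
      exact Finset.sum_congr rfl fun j _ => by ring
    · rw [Nat.cast_sub hQ]; push_cast; linarith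
  set f : ℝ → ℝ := fun y => dilationSum J c a y * y ^ (-p) with hf
  set f' : ℝ → ℝ := fun y =>
    a * (dilationSum J (fun j => j * c j) (a - 1) y * y ^ (-1 - (p - 1)))
      - p * (dilationSum J c a y * y ^ (-1 - p)) with hf'
  have hI : IntegrableOn f' (Ioi 0) := (hI2.const_mul a).sub (hI1.const_mul p)
  -- The convention 0^(-p) = 0 makes the value at 0 agree with the limit there, since |f y| ≤ C
  -- y^(Q-p).
  have hf0 : f 0 = 0 := by simp [hf, Real.zero_rpow (neg_ne_zero.2 hp.ne')]
  have hcont : ContinuousOn f (Ici 0) := by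
    intro y hy
    rcases eq_or_lt_of_le (show (0 : ℝ) ≤ y from hy) with rfl | hy
    · rw [ContinuousWithinAt, hf0]
      have hz : Tendsto (fun y : ℝ => C * y ^ (Q - p)) (𝓝[Ici 0] 0) (𝓝 0) := by
        have : ContinuousAt (fun y : ℝ => C * y ^ (Q - p)) 0 :=
          (Real.continuousAt_rpow_const _ _ (Or.inr (by linarith))).const_mul _
        have h2 := this.tendsto
        rw [Real.zero_rpow (by linarith), mul_zero] at h2
        exact h2.mono_left nhdsWithin_le_nhds
      refine squeeze_zero_norm' ?_ hz
      filter_upwards [self_mem_nhdsWithin, mem_nhdsWithin_of_mem_nhds (Iio_mem_nhds hr0)]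
        with y hy hyr
      have hy : (0 : ℝ) ≤ y := hy
      rcases hy.eq_or_lt with rfl | hy
      · rw [hf0, Real.zero_rpow (by linarith)]; simp
      · have e : y ^ (Q - p) = y ^ Q * y ^ (-p) := by
          rw [← Real.rpow_natCast, ← Real.rpow_add hy]; congr 1
        have hy0 : 0 ≤ y ^ (-p) := Real.rpow_nonneg hy.le _
        rw [norm_mul, Real.norm_eq_abs, Real.norm_of_nonneg hy0, e, ← mul_assoc]
        exact mul_le_mul_of_nonneg_right (hb y ⟨hy.le, le_of_lt hyr⟩) hy0
    · exact ((continuous_dilationSum J c ha).continuousAt.mul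
        (Real.continuousAt_rpow_const _ _ (Or.inl hy.ne'))).continuousWithinAt
  -- Differentiability fails at most at the kinks y = -1/j; being finite in number, they do not
  -- affect the fundamental theorem for the continuous f.
  have hderiv : ∀ y : ℝ, 0 < y → y ∉ (J : Set ℤ).image (fun j : ℤ => -((j : ℝ)⁻¹)) →
      HasDerivAt f (f' y) y := by
    intro y hy hyJ
    have h1 := hasDerivAt_dilationSum J c a (y := y) fun j hj h0 => hyJ ⟨j, hj, by
      have hj0 : (j : ℝ) ≠ 0 := by rintro h; rw [h] at h0; simp at h0
      simp only
      field_simp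
      linarith⟩
    have h2 := Real.hasDerivAt_rpow_const (x := y) (p := -p) (Or.inl hy.ne')
    refine (h1.mul h2).congr_deriv ?_
    simp only [hf']
    rw [show -1 - (p - 1) = -p by ring, show -p - 1 = -1 - p by ring]
    ring
  have hftc : ∀ b : ℝ, 0 ≤ b → ∫ y in (0 : ℝ)..b, f' y = f b := by
    intro b hb
    rw [integral_eq_of_hasDerivAt_off_countable_of_le f f' hb
      (J.countable_toSet.image fun j : ℤ => -((j : ℝ)⁻¹))
      (hcont.mono fun y hy => hy.1) (fun y hy => hderiv y hy.1.1 hy.2) ?_, hf0, sub_zero]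
    exact (intervalIntegrable_iff_integrableOn_Ioc_of_le hb).2
      (hI.mono_set fun y hy => hy.1)
  have hlim : Tendsto f atTop (𝓝 0) := by
    have : f = fun y => ∑ j ∈ J, c j * (posRpow a (1 + j * y) * y ^ (-p)) := by
      ext y; simp only [hf, dilationSum, Finset.sum_mul, mul_assoc]
    rw [this]
    have h := tendsto_finsetSum J fun j _ =>
      (tendsto_posRpow_mul_rpow_atTop j ha.le hap).const_mul (c j)
    simpa using h
  have hlim2 : Tendsto f atTop (𝓝 (∫ y in Ioi (0 : ℝ), f' y)) := by
    refine (intervalIntegral_tendsto_integral_Ioi 0 hI tendsto_id).congr' ?_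
    filter_upwards [eventually_ge_atTop 0] with b hb using hftc b hb
  have := tendsto_nhds_unique hlim hlim2
  rw [hf', integral_sub (hI2.const_mul a) (hI1.const_mul p), integral_const_mul,
    integral_const_mul] at this
  linarith

/-- Inserting `mul_dilationSum` into the integrated-by-parts identity restores the coefficients c
and the original kernel. -/
lemma sub_mul_integral_dilationSum {J : Finset ℤ} {c : ℤ → ℝ} {a p : ℝ} {Q : ℕ}
    (hc : ∀ q < Q, ∑ j ∈ J, c j * (j : ℝ) ^ q = 0) (ha : 0 < a) (hap : a < p) (hpQ : p < Q) :
    (a - p) * ∫ y in Ioi (0 : ℝ), dilationSum J c a y * y ^ (-1 - p)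
      = a * ∫ y in Ioi (0 : ℝ), dilationSum J c (a - 1) y * y ^ (-1 - p) := by
  have h := mul_integral_dilationSum hc ha hap hpQ
  have hp : 0 < p := ha.trans hap
  have hI1 := integrableOn_Ioi_zero_dilationSum hc (by linarith) hap hpQ (Or.inl hp)
  have hI2 := integrableOn_Ioi_zero_dilationSum (a := a - 1) hc (by linarith) (by linarith) hpQ
    (Or.inl hp)
  have e : ∫ y in Ioi (0 : ℝ), dilationSum J (fun j => j * c j) (a - 1) y * y ^ (-1 - (p - 1))
      = (∫ y in Ioi (0 : ℝ), dilationSum J c a y * y ^ (-1 - p))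
        - ∫ y in Ioi (0 : ℝ), dilationSum J c (a - 1) y * y ^ (-1 - p) := by
    rw [← integral_sub hI1 hI2]
    refine setIntegral_congr_fun measurableSet_Ioi fun y hy => ?_
    have hy : (0 : ℝ) < y := hy
    have e : y ^ (-1 - (p - 1)) = y * y ^ (-1 - p) := by
      rw [mul_comm, ← Real.rpow_add_one hy.ne']; congr 1; ring
    rw [e, ← sub_mul, ← mul_dilationSum]; ring
  rw [e] at h
  linarith

/-! ### The symmetric kernel integral -/

/-- The substitution `y = t / (1 - t)` exchanges `(1 + y)^(σ-1)` and `(1 - t)₊^(σ-1)`. -/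
lemma integral_Ioi_one_add_rpow {σ δ : ℝ} (hδ : 0 < δ) :
    ∫ y in Ioi δ, posRpow (σ - 1) (1 + y) * y ^ (-2 * σ)
      = ∫ t in Ioi (δ / (1 + δ)), posRpow (σ - 1) (1 - t) * t ^ (-2 * σ) := by
  have hδ1 : δ / (1 + δ) < 1 := by rw [div_lt_one (by linarith)]; linarith
  have hδ0 : 0 < δ / (1 + δ) := by positivity
  have him : (fun t : ℝ => t / (1 - t)) '' Ioo (δ / (1 + δ)) 1 = Ioi δ := by
    ext y
    constructor
    · rintro ⟨t, ⟨h1, h2⟩, rfl⟩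
      rw [div_lt_iff₀ (by linarith)] at h1
      have : 0 < 1 - t := by linarith
      change δ < t / (1 - t)
      rw [lt_div_iff₀ this]; linarith
    · intro (hy : δ < y)
      have hy0 : 0 < 1 + y := by linarith
      refine ⟨y / (1 + y), ⟨?_, ?_⟩, ?_⟩
      · rw [div_lt_div_iff₀ (by linarith) hy0]; linarith
      · rw [div_lt_one hy0]; linarith
      · simp only
        field_simp
        ring
  have hder : ∀ t ∈ Ioo (δ / (1 + δ)) 1,
      HasDerivWithinAt (fun t : ℝ => t / (1 - t)) (1 / (1 - t) ^ 2) (Ioo (δ / (1 + δ)) 1) t := by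
    intro t ht
    have h1 : 1 - t ≠ 0 := by linarith [ht.2]
    refine (((hasDerivAt_id t).div ((hasDerivAt_id t).const_sub 1) h1).congr_deriv
      ?_).hasDerivWithinAt
    simp
  have hinj : InjOn (fun t : ℝ => t / (1 - t)) (Ioo (δ / (1 + δ)) 1) := by
    intro t ht u hu h
    have h1 : 1 - t ≠ 0 := by linarith [ht.2]
    have h2 : 1 - u ≠ 0 := by linarith [hu.2]
    simp only at h
    rw [div_eq_div_iff h1 h2] at h
    linarith
  have hz : ∀ t ∈ Ioi (δ / (1 + δ)) \ Ioo (δ / (1 + δ)) 1,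
      posRpow (σ - 1) (1 - t) * t ^ (-2 * σ) = 0 := by
    rintro t ⟨h1, h2⟩
    have : 1 ≤ t := not_lt.1 fun h => h2 ⟨h1, h⟩
    rw [posRpow_of_nonpos (by linarith), zero_mul]
  rw [← him, integral_image_eq_integral_abs_deriv_smul measurableSet_Ioo hder hinj,
    setIntegral_eq_of_subset_of_forall_sdiff_eq_zero measurableSet_Ioi Ioo_subset_Ioi_self hz]
  refine setIntegral_congr_fun measurableSet_Ioo fun t ht => ?_
  have h0 : 0 < t := hδ0.trans ht.1
  have h1 : 0 < 1 - t := by linarith [ht.2]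
  have e : 1 + t / (1 - t) = (1 - t)⁻¹ := by field_simp; ring
  simp only [smul_eq_mul]
  rw [e, posRpow_of_pos (by positivity), posRpow_of_pos h1, abs_of_pos (by positivity),
    Real.div_rpow h0.le h1.le, Real.inv_rpow h1.le, div_eq_mul_inv (t ^ (-2 * σ)),
    ← Real.rpow_neg h1.le, ← Real.rpow_neg h1.le, one_div,
    ← Real.rpow_natCast (1 - t) 2, ← Real.rpow_neg h1.le]
  -- The exponents are -2 from the Jacobian, 1 - σ from (1 + y)^(σ-1) and 2σ from y^(-2σ).
  have : (1 - t) ^ (σ - 1) = (1 - t) ^ (-((2 : ℕ) : ℝ)) * (1 - t) ^ (-(σ - 1))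
      * (1 - t) ^ (- (-2 * σ)) := by
    rw [← Real.rpow_add h1, ← Real.rpow_add h1]; congr 1; push_cast; ring
  rw [this]; ring

/-- This is the dilation sum over {1, -1} with c_j = j: one vanishing moment, and p = 2σ - 1 < 1. -/
lemma integrableOn_symmetricKernel {σ : ℝ} (h0 : 0 < σ) (h1 : σ < 1) :
    IntegrableOn (fun y : ℝ =>
      (posRpow (σ - 1) (1 + y) - posRpow (σ - 1) (1 - y)) * y ^ (-2 * σ)) (Ioi 0) := by
  have h := integrableOn_Ioi_zero_dilationSum (J := {1, -1}) (c := fun j => (j : ℝ))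
    (a := σ - 1) (p := 2 * σ - 1) (Q := 1) (fun q hq => by
      obtain rfl : q = 0 := by omega
      rw [Finset.sum_pair (by norm_num)]; norm_num) (by linarith) (by linarith)
      (by push_cast; linarith) (Or.inr (by simp))
  refine h.congr_fun (fun y _ => ?_) measurableSet_Ioi
  simp only [dilationSum]
  rw [Finset.sum_pair (by norm_num)]
  push_cast
  rw [show -1 - (2 * σ - 1) = -2 * σ by ring, one_mul, one_mul,
    show 1 + -1 * y = 1 - y by ring]
  ring

/-- The one-dimensional identity behind the harmonicity of truncated powers. -/
lemma integral_symmetricKernel {σ : ℝ} (h0 : 0 < σ) (h1 : σ < 1) :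
    ∫ y in Ioi (0 : ℝ),
      (posRpow (σ - 1) (1 + y) - posRpow (σ - 1) (1 - y)) * y ^ (-2 * σ) = 0 := by
  set P : ℝ → ℝ := fun y =>
      (posRpow (σ - 1) (1 + y) - posRpow (σ - 1) (1 - y)) * y ^ (-2 * σ) with hP
  set g : ℝ → ℝ := fun y => posRpow (σ - 1) (1 - y) * y ^ (-2 * σ) with hg
  have hint := integrableOn_symmetricKernel h0 h1
  have hgi : ∀ δ : ℝ, 0 < δ → IntegrableOn g (Ioi δ) := fun δ hδ => by
    have := integrableOn_Ioi_posRpow_mul_rpow (a := σ - 1) (p := 2 * σ - 1) (-1) (by linarith)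
      (by linarith) (Or.inr (by norm_num)) hδ
    refine this.congr_fun (fun y _ => ?_) measurableSet_Ioi
    simp only [hg]
    push_cast
    rw [show -1 - (2 * σ - 1) = -2 * σ by ring, show 1 + -1 * y = 1 - y by ring]
  have hgi' : ∀ δ : ℝ, 0 < δ →
      IntegrableOn (fun y : ℝ => posRpow (σ - 1) (1 + y) * y ^ (-2 * σ)) (Ioi δ) := fun δ hδ => by
    have := integrableOn_Ioi_posRpow_mul_rpow (a := σ - 1) (p := 2 * σ - 1) 1 (by linarith)
      (by linarith) (Or.inr (by norm_num)) hδ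
    refine this.congr_fun (fun y _ => ?_) measurableSet_Ioi
    simp only
    push_cast
    rw [show -1 - (2 * σ - 1) = -2 * σ by ring, one_mul]
  -- The two halves diverge separately at 0 when σ ≥ 1/2, hence the cutoff. After the substitution
  -- they are tails of the same g with different lower limits.
  have hcut : ∀ δ : ℝ, 0 < δ → ∫ y in Ioi δ, P y = ∫ y in (δ / (1 + δ))..δ, g y := by
    intro δ hδ
    have : ∫ y in Ioi δ, P y
        = (∫ y in Ioi δ, posRpow (σ - 1) (1 + y) * y ^ (-2 * σ)) - ∫ y in Ioi δ, g y := by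
      rw [← integral_sub (hgi' δ hδ) (hgi δ hδ)]
      simp only [hP, hg, sub_mul]
    rw [this, integral_Ioi_one_add_rpow hδ]
    exact intervalIntegral.integral_Ioi_sub_Ioi' (hgi _ (by positivity)) (hgi δ hδ)
  have hlim1 : Tendsto (fun δ : ℝ => ∫ y in Ioi δ, P y) (𝓝[>] 0) (𝓝 (∫ y in Ioi (0 : ℝ), P y)) := by
    have hc : ContinuousWithinAt (fun δ : ℝ => ∫ y in (0 : ℝ)..δ, P y) (Icc 0 1) 0 := by
      refine (intervalIntegral.continuousOn_primitive_interval' (a := 0) (b₁ := 0) (b₂ := 1)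
        ?_ (by simp)).continuousWithinAt (by simp) |>.mono (by simp)
      exact (intervalIntegrable_iff_integrableOn_Ioc_of_le zero_le_one).2
        (hint.mono_set fun y hy => hy.1)
    have hc' : Tendsto (fun δ : ℝ => ∫ y in (0 : ℝ)..δ, P y) (𝓝[>] 0) (𝓝 0) := by
      have h2 := hc.tendsto
      rw [intervalIntegral.integral_same] at h2
      refine h2.mono_left ?_
      rw [← nhdsWithin_Ioc_eq_nhdsGT (zero_lt_one (α := ℝ))]
      exact nhdsWithin_mono _ Ioc_subset_Icc_self
    have h3 := tendsto_const_nhds (x := ∫ y in Ioi (0 : ℝ), P y) |>.sub hc'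
    rw [sub_zero] at h3
    refine h3.congr' ?_
    filter_upwards [self_mem_nhdsWithin] with δ hδ
    rw [← intervalIntegral.integral_Ioi_sub_Ioi hint (le_of_lt hδ)]
    ring
  -- The leftover interval has length at most δ², and g is O(δ^(-2σ)) on it.
  have hlim2 : Tendsto (fun δ : ℝ => ∫ y in Ioi δ, P y) (𝓝[>] 0) (𝓝 0) := by
    have hz : Tendsto (fun δ : ℝ => (1 / 2 : ℝ) ^ (σ - 1) * (1 / 2 : ℝ) ^ (-2 * σ)
        * δ ^ (2 - 2 * σ)) (𝓝[>] 0) (𝓝 0) := by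
      have : ContinuousAt (fun δ : ℝ => (1 / 2 : ℝ) ^ (σ - 1) * (1 / 2 : ℝ) ^ (-2 * σ)
          * δ ^ (2 - 2 * σ)) 0 :=
        (Real.continuousAt_rpow_const _ _ (Or.inr (by linarith))).const_mul _
      have h2 := this.tendsto
      rw [Real.zero_rpow (by linarith), mul_zero] at h2
      exact h2.mono_left nhdsWithin_le_nhds
    refine squeeze_zero_norm' ?_ hz
    filter_upwards [self_mem_nhdsWithin,
      mem_nhdsWithin_of_mem_nhds (Iio_mem_nhds (show (0 : ℝ) < 1 / 2 by norm_num))] with δ hδ hδ2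
    have hδ : 0 < δ := hδ
    have hδ2 : δ < 1 / 2 := hδ2
    rw [hcut δ hδ]
    have hle : δ / (1 + δ) ≤ δ := div_le_self hδ.le (by linarith)
    have hge : 1 / 2 * δ ≤ δ / (1 + δ) := by
      rw [le_div_iff₀ (by linarith)]; nlinarith
    have hb : ∀ t ∈ uIoc (δ / (1 + δ)) δ,
        ‖g t‖ ≤ (1 / 2 : ℝ) ^ (σ - 1) * ((1 / 2 : ℝ) ^ (-2 * σ) * δ ^ (-2 * σ)) := by
      intro t ht
      rw [uIoc_of_le hle] at ht
      have ht0 : 1 / 2 * δ < t := hge.trans_lt ht.1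
      have ht0' : 0 < t := lt_trans (by positivity) ht0
      have ht1 : 1 / 2 ≤ 1 - t := by linarith [ht.2]
      simp only [hg]
      rw [posRpow_of_pos (by linarith), Real.norm_of_nonneg
        (mul_nonneg (Real.rpow_nonneg (by linarith) _) (Real.rpow_nonneg ht0'.le _)),
        ← Real.mul_rpow (by norm_num) hδ.le]
      exact mul_le_mul (Real.rpow_le_rpow_of_nonpos (by norm_num) ht1 (by linarith))
        (Real.rpow_le_rpow_of_nonpos (by positivity) ht0.le (by linarith))
        (Real.rpow_nonneg ht0'.le _) (by positivity)
    refine (intervalIntegral.norm_integral_le_of_norm_le_const hb).trans ?_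
    have hlen : |δ - δ / (1 + δ)| ≤ δ ^ 2 := by
      rw [abs_of_nonneg (by linarith)]
      have : δ - δ / (1 + δ) = δ ^ 2 / (1 + δ) := by field_simp; ring
      rw [this]
      exact div_le_self (by positivity) (by linarith)
    have e : δ ^ (2 - 2 * σ) = δ ^ (-2 * σ) * δ ^ 2 := by
      rw [← Real.rpow_natCast δ 2, ← Real.rpow_add hδ]; congr 1; push_cast; ring
    rw [e]
    calc _ ≤ (1 / 2 : ℝ) ^ (σ - 1) * ((1 / 2 : ℝ) ^ (-2 * σ) * δ ^ (-2 * σ)) * δ ^ 2 := by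
          gcongr
      _ = _ := by ring
  exact tendsto_nhds_unique hlim1 hlim2

/-- Scaling y by |j| reduces to j = 1; the integrand is odd in j and zero for j = 0. -/
lemma integral_scaled_symmetricKernel {σ : ℝ} (h0 : 0 < σ) (h1 : σ < 1) (j : ℤ) :
    IntegrableOn (fun y : ℝ =>
        (posRpow (σ - 1) (1 + j * y) - posRpow (σ - 1) (1 - j * y)) * y ^ (-2 * σ)) (Ioi 0) ∧
      ∫ y in Ioi (0 : ℝ),
        (posRpow (σ - 1) (1 + j * y) - posRpow (σ - 1) (1 - j * y)) * y ^ (-2 * σ) = 0 := by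
  have pos : ∀ b : ℝ, 0 < b → IntegrableOn (fun y : ℝ =>
        (posRpow (σ - 1) (1 + b * y) - posRpow (σ - 1) (1 - b * y)) * y ^ (-2 * σ)) (Ioi 0) ∧
      ∫ y in Ioi (0 : ℝ),
        (posRpow (σ - 1) (1 + b * y) - posRpow (σ - 1) (1 - b * y)) * y ^ (-2 * σ) = 0 := by
    intro b hb
    set P : ℝ → ℝ := fun y =>
      (posRpow (σ - 1) (1 + y) - posRpow (σ - 1) (1 - y)) * y ^ (-2 * σ) with hP
    have e : EqOn (fun y => b ^ (2 * σ) * P (b * y)) (fun y : ℝ =>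
        (posRpow (σ - 1) (1 + b * y) - posRpow (σ - 1) (1 - b * y)) * y ^ (-2 * σ)) (Ioi 0) := by
      intro y hy
      have hy : 0 < y := hy
      simp only [hP]
      rw [Real.mul_rpow hb.le hy.le, show -2 * σ = -(2 * σ) by ring, Real.rpow_neg hb.le]
      have : b ^ (2 * σ) ≠ 0 := (Real.rpow_pos_of_pos hb _).ne'
      field_simp
    refine ⟨IntegrableOn.congr_fun (Integrable.const_mul ?_ _) e measurableSet_Ioi, ?_⟩
    · have := (integrableOn_Ioi_comp_mul_left_iff P 0 hb).2
        (by rw [mul_zero]; exact integrableOn_symmetricKernel h0 h1)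
      exact this
    · rw [← setIntegral_congr_fun measurableSet_Ioi e, integral_const_mul,
        integral_comp_mul_left_Ioi P 0 hb, mul_zero, integral_symmetricKernel h0 h1]
      simp
  rcases lt_trichotomy j 0 with hj | hj | hj
  · obtain ⟨i1, i2⟩ := pos (-(j : ℝ)) (by simpa using hj)
    have e : (fun y : ℝ =>
        (posRpow (σ - 1) (1 + j * y) - posRpow (σ - 1) (1 - j * y)) * y ^ (-2 * σ))
        = fun y => -((posRpow (σ - 1) (1 + -(j : ℝ) * y) - posRpow (σ - 1) (1 - -(j : ℝ) * y))
          * y ^ (-2 * σ)) := by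
      ext y
      rw [show 1 + -(j : ℝ) * y = 1 - j * y by ring, show 1 - -(j : ℝ) * y = 1 + j * y by ring]
      ring
    rw [e]
    exact ⟨i1.neg, by rw [integral_neg, i2, neg_zero]⟩
  · subst hj; simp
  · exact pos j (by exact_mod_cast hj)

/-- Averaging the sum with its reflection j ↦ -j expresses it through the symmetric kernels. -/
lemma integral_dilationSum_of_odd {J : Finset ℤ} {c : ℤ → ℝ} {σ : ℝ} (hJ : ∀ j ∈ J, -j ∈ J)
    (hc : ∀ j, c (-j) = -c j) (h0 : 0 < σ) (h1 : σ < 1) :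
    ∫ y in Ioi (0 : ℝ), dilationSum J c (σ - 1) y * y ^ (-2 * σ) = 0 := by
  have e : ∀ y : ℝ, dilationSum J c (σ - 1) y * y ^ (-2 * σ) = ∑ j ∈ J, c j / 2 *
      ((posRpow (σ - 1) (1 + j * y) - posRpow (σ - 1) (1 - j * y)) * y ^ (-2 * σ)) := by
    intro y
    have h : dilationSum J c (σ - 1) y = -∑ j ∈ J, c j * posRpow (σ - 1) (1 - j * y) := by
      rw [dilationSum, ← Finset.sum_neg_distrib]
      refine Finset.sum_nbij' (fun j => -j) (fun j => -j) hJ hJ (by simp) (by simp) fun j _ => ?_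
      rw [hc]; push_cast
      rw [show 1 - -(j : ℝ) * y = 1 + j * y by ring]; ring
    have h' : dilationSum J c (σ - 1) y = (∑ j ∈ J, c j * posRpow (σ - 1) (1 + j * y)
        - ∑ j ∈ J, c j * posRpow (σ - 1) (1 - j * y)) / 2 := by
      have : dilationSum J c (σ - 1) y = ∑ j ∈ J, c j * posRpow (σ - 1) (1 + j * y) := rfl
      linarith
    rw [h', ← Finset.sum_sub_distrib, Finset.sum_div, Finset.sum_mul]
    exact Finset.sum_congr rfl fun j _ => by ring
  simp only [e]
  rw [integral_finsetSum _ fun j _ =>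
    (integral_scaled_symmetricKernel h0 h1 j).1.const_mul _]
  refine Finset.sum_eq_zero fun j _ => ?_
  rw [integral_const_mul, (integral_scaled_symmetricKernel h0 h1 j).2, mul_zero]

/-! ### Vanishing of the one-dimensional integral -/

/-- Iterated integration by parts for coefficients with `M + 1` vanishing moments: each step
divides the coefficients by `j` and raises both exponents by one. -/
lemma integral_dilationSum_pow_mul {J : Finset ℤ} {c : ℤ → ℝ} {σ : ℝ} {M : ℕ}
    (hJ : ∀ j ∈ J, -j ∈ J) (hodd : ∀ j : ℤ, (-j : ℝ) ^ M * c (-j) = -((j : ℝ) ^ M * c j))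
    (h0 : 0 < σ) (h1 : σ < 1)
    (hc : ∀ q < M + 1, ∑ j ∈ J, c j * (j : ℝ) ^ q = 0) (i : ℕ) (hi : i ≤ M) :
    ∫ y in Ioi (0 : ℝ), dilationSum J (fun j : ℤ => (j : ℝ) ^ (M - i) * c j) (σ - 1 + i) y
      * y ^ (-1 - (2 * σ - 1 + i)) = 0 := by
  induction i with
  | zero =>
    have := integral_dilationSum_of_odd (c := fun j : ℤ => (j : ℝ) ^ M * c j) hJ
      (fun j => by simpa using hodd j) h0 h1
    simp only [Nat.sub_zero, Nat.cast_zero, add_zero]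
    rwa [show -1 - (2 * σ - 1) = -2 * σ by ring]
  | succ i ih =>
    -- The coefficients j^(M-i-1) c_j retain exactly i + 2 of the M + 1 vanishing moments, enough
    -- since p = 2σ + i < i + 2.
    have h := mul_integral_dilationSum (J := J) (c := fun j : ℤ => (j : ℝ) ^ (M - (i + 1)) * c j)
      (a := σ - 1 + (i + 1 : ℕ)) (p := 2 * σ - 1 + (i + 1 : ℕ)) (Q := i + 2) (fun q hq => by
        rw [← hc (M - (i + 1) + q) (by omega)]
        exact Finset.sum_congr rfl fun j _ => by rw [pow_add]; ring)
      (by push_cast; have : (0 : ℝ) ≤ i := i.cast_nonneg; linarith) (by linarith)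
      (by push_cast; linarith)
    have e : (fun j : ℤ => (j : ℝ) * ((j : ℝ) ^ (M - (i + 1)) * c j))
        = fun j : ℤ => (j : ℝ) ^ (M - i) * c j := by
      ext j
      rw [show M - i = M - (i + 1) + 1 by omega, pow_succ]; ring
    rw [e, show σ - 1 + ((i + 1 : ℕ) : ℝ) - 1 = σ - 1 + i by push_cast; ring,
      show 2 * σ - 1 + ((i + 1 : ℕ) : ℝ) - 1 = 2 * σ - 1 + i by push_cast; ring,
      ih (by omega), mul_zero] at h
    refine (mul_eq_zero.1 h).resolve_left ?_
    have : (0 : ℝ) ≤ i := i.cast_nonneg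
    push_cast
    linarith

/-- Vanishing of `∫₀^∞ ∑ c_j (1 + j y)₊^(k+σ-1) y^(-1-2s) dy`, `s = m + σ`, `k ≤ 2m + 1`. -/
lemma integral_dilationSum_eq_zero {J : Finset ℤ} {c : ℤ → ℝ} {σ : ℝ} {m : ℕ}
    (hJ : ∀ j ∈ J, -j ∈ J) (heven : ∀ j, c (-j) = c j) (h0 : 0 < σ) (h1 : σ < 1)
    (hc : ∀ q < 2 * m + 2, ∑ j ∈ J, c j * (j : ℝ) ^ q = 0) (k : ℕ) (hk : k ≤ 2 * m + 1) :
    ∫ y in Ioi (0 : ℝ), dilationSum J c (k + σ - 1) y * y ^ (-1 - 2 * (m + σ)) = 0 := by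
  induction hk using Nat.decreasingInduction with
  | self =>
    have h := integral_dilationSum_pow_mul (M := 2 * m + 1) hJ (fun j => by
      rw [heven, Odd.neg_pow ⟨m, rfl⟩]; ring) h0 h1 hc _ le_rfl
    simp only [Nat.sub_self, pow_zero, one_mul] at h
    rw [show -1 - (2 * σ - 1 + ((2 * m + 1 : ℕ) : ℝ)) = -1 - 2 * (m + σ) by push_cast; ring,
      show σ - 1 + ((2 * m + 1 : ℕ) : ℝ) = ((2 * m + 1 : ℕ) : ℝ) + σ - 1 by push_cast; ring] at h
    exact h
  | of_succ k hk ih =>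
    have hk' : (k : ℝ) + 1 ≤ 2 * m + 1 := by exact_mod_cast hk
    -- With a = k + σ > 0, vanishing for a gives vanishing for a - 1 after division by a.
    have h := sub_mul_integral_dilationSum (a := ((k + 1 : ℕ) : ℝ) + σ - 1) (p := 2 * (m + σ))
      hc (by push_cast; have : (0 : ℝ) ≤ k := k.cast_nonneg; linarith)
      (by push_cast; linarith) (by push_cast; linarith)
    rw [ih, mul_zero, eq_comm, mul_eq_zero] at h
    rw [show ((k + 1 : ℕ) : ℝ) + σ - 1 - 1 = k + σ - 1 by push_cast; ring] at h
    refine h.resolve_left ?_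
    have : (0 : ℝ) ≤ k := k.cast_nonneg
    push_cast
    linarith

/-! ### Reduction to the first coordinate -/

/-- Splitting off the first coordinate of a Euclidean space preserves the volume. -/
lemma exists_measurePreserving_split (N : ℕ) [NeZero N] :
    ∃ (n : ℕ) (e : EuclideanSpace ℝ (Fin N) ≃ᵐ ℝ × EuclideanSpace ℝ (Fin n)),
      N = n + 1 ∧ MeasurePreserving e volume (volume.prod volume) ∧ (∀ x, (e x).1 = x 0) ∧
        ∀ x, ‖x‖ ^ 2 = (e x).1 ^ 2 + ‖(e x).2‖ ^ 2 := by
  obtain ⟨n, rfl⟩ := Nat.exists_eq_succ_of_ne_zero (NeZero.ne N)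
  refine ⟨n, ((MeasurableEquiv.toLp 2 (Fin (n + 1) → ℝ)).symm.trans
    (MeasurableEquiv.piFinSuccAbove (fun _ => ℝ) 0)).trans
    (MeasurableEquiv.prodCongr (MeasurableEquiv.refl ℝ) (MeasurableEquiv.toLp 2 (Fin n → ℝ))),
    rfl, ?_, fun x => rfl, fun x => ?_⟩
  · have h1 := EuclideanSpace.volume_preserving_symm_measurableEquiv_toLp (Fin (n + 1))
    have h2 := volume_preserving_piFinSuccAbove (fun _ : Fin (n + 1) => ℝ) 0
    have h3 := (MeasurePreserving.id (volume : Measure ℝ)).prod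
      (EuclideanSpace.volume_preserving_symm_measurableEquiv_toLp (Fin n)).symm
    exact h3.comp (h2.comp h1)
  · rw [EuclideanSpace.norm_sq_eq, EuclideanSpace.norm_sq_eq, Fin.sum_univ_succ]
    simp only [Real.norm_eq_abs, sq_abs]
    rfl

/-- Substitute z = ρ w: the Jacobian ρ^n against ρ^(-n-1-q) leaves ρ^(-1-q). -/
lemma integral_sq_add_norm_sq_rpow (n : ℕ) {q ρ : ℝ} (hq : 0 < q) (hρ : 0 < ρ) :
    Integrable (fun z : EuclideanSpace ℝ (Fin n) =>
        (ρ ^ 2 + ‖z‖ ^ 2) ^ (-((n : ℝ) + 1 + q) / 2)) ∧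
      ∫ z : EuclideanSpace ℝ (Fin n), (ρ ^ 2 + ‖z‖ ^ 2) ^ (-((n : ℝ) + 1 + q) / 2)
        = (∫ z : EuclideanSpace ℝ (Fin n), (1 + ‖z‖ ^ 2) ^ (-((n : ℝ) + 1 + q) / 2))
          * ρ ^ (-1 - q) := by
  set β : ℝ := (n : ℝ) + 1 + q with hβ
  have hI : Integrable (fun z : EuclideanSpace ℝ (Fin n) => (1 + ‖z‖ ^ 2) ^ (-β / 2)) :=
    integrable_rpow_neg_one_add_norm_sq (by simp [hβ]; linarith)
  have e : (fun z : EuclideanSpace ℝ (Fin n) => (ρ ^ 2 + ‖z‖ ^ 2) ^ (-β / 2))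
      = fun z => ρ ^ (-β) * (1 + ‖ρ⁻¹ • z‖ ^ 2) ^ (-β / 2) := by
    ext z
    have : ρ ^ 2 + ‖z‖ ^ 2 = ρ ^ 2 * (1 + ‖ρ⁻¹ • z‖ ^ 2) := by
      rw [norm_smul, mul_pow, norm_inv, Real.norm_of_nonneg hρ.le]
      field_simp
    rw [this, Real.mul_rpow (by positivity) (by positivity), ← Real.rpow_natCast ρ 2,
      ← Real.rpow_mul hρ.le]
    congr 2
    push_cast; ring
  rw [e]
  refine ⟨(hI.comp_smul (inv_ne_zero hρ.ne')).const_mul _, ?_⟩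
  rw [integral_const_mul, Measure.integral_comp_smul volume
    (fun z : EuclideanSpace ℝ (Fin n) => (1 + ‖z‖ ^ 2) ^ (-β / 2)) ρ⁻¹, smul_eq_mul,
    finrank_euclideanSpace_fin, abs_of_nonneg (by positivity), inv_pow, inv_inv]
  have : ρ ^ (-1 - q) = ρ ^ (-β) * ρ ^ n := by
    rw [← Real.rpow_natCast, ← Real.rpow_add hρ]; congr 1; rw [hβ]; ring
  rw [this]; ring

/-- Integrating out all coordinates but the first. -/
lemma integral_prod_mul_sq_add_norm_sq_rpow (n : ℕ) {q : ℝ} (hq : 0 < q) {g ρ : ℝ → ℝ}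
    (hg : Measurable g) (hρ : Measurable ρ) (hρ0 : ∀ᵐ t, 0 < ρ t)
    (hint : Integrable fun t => g t * ρ t ^ (-1 - q)) :
    Integrable (fun z : ℝ × EuclideanSpace ℝ (Fin n) =>
        g z.1 * (ρ z.1 ^ 2 + ‖z.2‖ ^ 2) ^ (-((n : ℝ) + 1 + q) / 2)) (volume.prod volume) ∧
      ∫ z : ℝ × EuclideanSpace ℝ (Fin n),
        g z.1 * (ρ z.1 ^ 2 + ‖z.2‖ ^ 2) ^ (-((n : ℝ) + 1 + q) / 2) ∂(volume.prod volume)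
        = (∫ z : EuclideanSpace ℝ (Fin n), (1 + ‖z‖ ^ 2) ^ (-((n : ℝ) + 1 + q) / 2))
          * ∫ t, g t * ρ t ^ (-1 - q) := by
  have hmeas : Measurable (fun z : ℝ × EuclideanSpace ℝ (Fin n) =>
      g z.1 * (ρ z.1 ^ 2 + ‖z.2‖ ^ 2) ^ (-((n : ℝ) + 1 + q) / 2)) := by fun_prop
  have hI : Integrable (fun z : ℝ × EuclideanSpace ℝ (Fin n) =>
      g z.1 * (ρ z.1 ^ 2 + ‖z.2‖ ^ 2) ^ (-((n : ℝ) + 1 + q) / 2)) (volume.prod volume) := by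
    rw [integrable_prod_iff hmeas.aestronglyMeasurable]
    refine ⟨?_, ?_⟩
    · filter_upwards [hρ0] with t ht
      exact (integral_sq_add_norm_sq_rpow n hq ht).1.const_mul _
    · refine (hint.norm.const_mul (∫ z : EuclideanSpace ℝ (Fin n),
        (1 + ‖z‖ ^ 2) ^ (-((n : ℝ) + 1 + q) / 2))).congr ?_
      filter_upwards [hρ0] with t ht
      have : ∀ z : EuclideanSpace ℝ (Fin n),
          ‖g t * (ρ t ^ 2 + ‖z‖ ^ 2) ^ (-((n : ℝ) + 1 + q) / 2)‖
            = ‖g t‖ * (ρ t ^ 2 + ‖z‖ ^ 2) ^ (-((n : ℝ) + 1 + q) / 2) := fun z => by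
        rw [norm_mul, Real.norm_of_nonneg (Real.rpow_nonneg (by positivity) _)]
      simp only [this]
      rw [integral_const_mul, (integral_sq_add_norm_sq_rpow n hq ht).2, norm_mul,
        Real.norm_of_nonneg (Real.rpow_nonneg ht.le _)]
      ring
  refine ⟨hI, ?_⟩
  rw [integral_prod _ hI, ← integral_const_mul]
  refine integral_congr_ae ?_
  filter_upwards [hρ0] with t ht
  rw [integral_const_mul, (integral_sq_add_norm_sq_rpow n hq ht).2]
  ring

lemma norm_rpow_eq_sq_rpow {E : Type*} [NormedAddCommGroup E] (x : E) (β : ℝ) :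
    (‖x‖ ^ β)⁻¹ = (‖x‖ ^ 2) ^ (-β / 2) := by
  rw [← Real.rpow_neg (norm_nonneg _), ← Real.rpow_natCast, ← Real.rpow_mul (norm_nonneg _)]
  congr 1; push_cast; ring

/-- Functions of the first coordinate against the kernel `|y|^(-N-q)`. -/
lemma integral_comp_zero_div_norm_rpow (N : ℕ) [NeZero N] {q : ℝ} (hq : 0 < q) {g : ℝ → ℝ}
    (hg : Measurable g) (hint : Integrable fun t => g t * |t| ^ (-1 - q)) :
    Integrable (fun y : EuclideanSpace ℝ (Fin N) => g (y 0) / ‖y‖ ^ ((N : ℝ) + q)) ∧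
      ((∫ t, g t * |t| ^ (-1 - q)) = 0 →
        ∫ y : EuclideanSpace ℝ (Fin N), g (y 0) / ‖y‖ ^ ((N : ℝ) + q) = 0) := by
  obtain ⟨n, e, hn, hmp, he0, hen⟩ := exists_measurePreserving_split N
  have hN : (N : ℝ) = n + 1 := by exact_mod_cast hn
  have hpos : ∀ᵐ t : ℝ, 0 < |t| := by
    filter_upwards [Measure.ae_ne volume (0 : ℝ)] with t ht using abs_pos.2 ht
  obtain ⟨h1, h2⟩ := integral_prod_mul_sq_add_norm_sq_rpow n hq hg measurable_norm hpos hint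
  have hcomp : (fun y : EuclideanSpace ℝ (Fin N) => g (y 0) / ‖y‖ ^ ((N : ℝ) + q))
      = (fun z : ℝ × EuclideanSpace ℝ (Fin n) =>
        g z.1 * (‖z.1‖ ^ 2 + ‖z.2‖ ^ 2) ^ (-((n : ℝ) + 1 + q) / 2)) ∘ e := by
    ext y
    simp only [Function.comp]
    rw [div_eq_mul_inv, norm_rpow_eq_sq_rpow, hen, he0, Real.norm_eq_abs, sq_abs, hN]
  rw [hcomp]
  refine ⟨(hmp.integrable_comp_emb e.measurableEmbedding).2 h1, fun h0 => ?_⟩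
  have := hmp.integral_comp e.measurableEmbedding (fun z : ℝ × EuclideanSpace ℝ (Fin n) =>
        g z.1 * (‖z.1‖ ^ 2 + ‖z.2‖ ^ 2) ^ (-((n : ℝ) + 1 + q) / 2))
  simp only [Function.comp_def]
  rw [this]
  simp only [Real.norm_eq_abs] at h2 ⊢
  rw [h2, h0, mul_zero]

/-! ### Membership in the weighted space -/

lemma posPartPow_eq_posRpow (N : ℕ) [NeZero N] (a : ℝ) (x : EuclideanSpace ℝ (Fin N)) :
    posPartPow N a x = posRpow a (x 0) := rfl

lemma measurable_posPartPow (N : ℕ) [NeZero N] (a : ℝ) : Measurable (posPartPow N a) :=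
  (measurable_posRpow a).comp (by fun_prop : Measurable fun x : EuclideanSpace ℝ (Fin N) => x 0)

/-- What remains of the weight (1 + |x|²)^(-(N+q)/2) after integrating out the other coordinates. -/
lemma integrable_posRpow_mul_sqrt_rpow {a q : ℝ} (ha : -1 < a) (haq : a < q) :
    Integrable fun t : ℝ => posRpow a t * √(1 + t ^ 2) ^ (-1 - q) := by
  have hmeas : Measurable fun t : ℝ => posRpow a t * √(1 + t ^ 2) ^ (-1 - q) :=
    (measurable_posRpow a).mul (by fun_prop)
  have hIc : IntegrableOn (fun t : ℝ => posRpow a t * √(1 + t ^ 2) ^ (-1 - q)) (Iic 0) := by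
    refine integrableOn_zero.congr_fun (fun t ht => ?_) measurableSet_Iic
    simp only
    rw [posRpow_of_nonpos ht, zero_mul]
  have hIoc : IntegrableOn (fun t : ℝ => posRpow a t * √(1 + t ^ 2) ^ (-1 - q)) (Ioc 0 1) := by
    have h := (intervalIntegrable_posRpow ha 0 1).mul_continuousOn
      (g := fun t : ℝ => √(1 + t ^ 2) ^ (-1 - q)) (Continuous.continuousOn (by
        refine Continuous.rpow_const (by fun_prop) fun t => Or.inl ?_
        positivity))
    exact (intervalIntegrable_iff_integrableOn_Ioc_of_le zero_le_one).1 h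
  have hIoi : IntegrableOn (fun t : ℝ => posRpow a t * √(1 + t ^ 2) ^ (-1 - q)) (Ioi 1) := by
    refine (integrableOn_Ioi_rpow_of_lt (a := a - 1 - q) (by linarith) zero_lt_one).mono'
      hmeas.aestronglyMeasurable ?_
    refine (ae_restrict_iff' measurableSet_Ioi).2 (Eventually.of_forall fun t ht => ?_)
    have ht : 0 < t := zero_lt_one.trans ht
    have e : t ^ (a - 1 - q) = t ^ a * t ^ (-1 - q) := by
      rw [← Real.rpow_add ht]; congr 1; ring
    rw [posRpow_of_pos ht, Real.norm_of_nonneg (by positivity), e]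
    refine mul_le_mul_of_nonneg_left ?_ (by positivity)
    exact Real.rpow_le_rpow_of_nonpos ht (Real.le_sqrt_of_sq_le (by linarith)) (by linarith)
  have := hIc.union (hIoc.union hIoi)
  rwa [Ioc_union_Ioi_eq_Ioi zero_le_one, Iic_union_Ioi, integrableOn_univ] at this

/-- `(x₁)₊^a` lies in the weighted space `𝓛¹_s` for `-1 < a < 2s`. -/
lemma memWeightedL1_posPartPow (N : ℕ) [NeZero N] {a s : ℝ} (ha : -1 < a) (hs : 0 < s)
    (has : a < 2 * s) : MemWeightedL1 s (posPartPow N a) := by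
  have hmeas := measurable_posPartPow N a
  have hβ : 0 < (N : ℝ) + 2 * s := by positivity
  have hint : Integrable (fun x : EuclideanSpace ℝ (Fin N) =>
      |posPartPow N a x| / (1 + ‖x‖ ^ ((N : ℝ) + 2 * s))) := by
    obtain ⟨n, e, hn, hmp, he0, hen⟩ := exists_measurePreserving_split N
    have h1 := (integral_prod_mul_sq_add_norm_sq_rpow n (q := 2 * s) (by positivity)
      (measurable_posRpow a)
      (ρ := fun t => √(1 + t ^ 2)) (by fun_prop) (Eventually.of_forall fun t => by positivity)
      (integrable_posRpow_mul_sqrt_rpow ha has)).1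
    have h2 := ((hmp.integrable_comp_emb e.measurableEmbedding).2 h1).const_mul
      ((2 : ℝ) ^ (((N : ℝ) + 2 * s) / 2))
    refine h2.mono' (Measurable.aestronglyMeasurable (by fun_prop))
      (Eventually.of_forall fun x => ?_)
    simp only [Function.comp]
    have e1 : √(1 + (e x).1 ^ 2) ^ 2 + ‖(e x).2‖ ^ 2 = 1 + ‖x‖ ^ 2 := by
      rw [Real.sq_sqrt (by positivity), hen]; ring
    have hN : (n : ℝ) + 1 + 2 * s = N + 2 * s := by rw [hn]; push_cast; ring
    rw [e1, he0, hN, posPartPow_eq_posRpow, abs_of_nonneg (posRpow_nonneg _ _),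
      Real.norm_of_nonneg (div_nonneg (posRpow_nonneg _ _) (by positivity)), div_eq_mul_inv,
      mul_left_comm]
    refine mul_le_mul_of_nonneg_left ?_ (posRpow_nonneg _ _)
    set β := (N : ℝ) + 2 * s
    rw [neg_div, Real.rpow_neg (by positivity), ← div_eq_mul_inv, le_div_iff₀ (by positivity),
      inv_mul_le_iff₀ (by positivity), mul_comm]
    have e2 : (‖x‖ ^ 2) ^ (β / 2) = ‖x‖ ^ β := by
      rw [← Real.rpow_natCast, ← Real.rpow_mul (norm_nonneg _)]; congr 1; push_cast; ring
    rcases le_total (‖x‖ ^ 2) 1 with h | h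
    · calc (1 + ‖x‖ ^ 2) ^ (β / 2) ≤ 2 ^ (β / 2) :=
            Real.rpow_le_rpow (by positivity) (by linarith) (by positivity)
        _ ≤ 2 ^ (β / 2) * (1 + ‖x‖ ^ β) :=
            le_mul_of_one_le_right (by positivity) (by
              linarith [Real.rpow_nonneg (norm_nonneg x) β])
    · calc (1 + ‖x‖ ^ 2) ^ (β / 2) ≤ (2 * ‖x‖ ^ 2) ^ (β / 2) :=
            Real.rpow_le_rpow (by positivity) (by linarith) (by positivity)
        _ = 2 ^ (β / 2) * ‖x‖ ^ β := by rw [Real.mul_rpow (by norm_num) (by positivity), e2]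
        _ ≤ 2 ^ (β / 2) * (1 + ‖x‖ ^ β) := by gcongr; linarith
  refine ⟨?_, hint⟩
  have hcont : Continuous fun x : EuclideanSpace ℝ (Fin N) => 1 + ‖x‖ ^ ((N : ℝ) + 2 * s) :=
    continuous_const.add (continuous_norm.rpow_const fun _ => Or.inr hβ.le)
  have hloc : LocallyIntegrable (fun x : EuclideanSpace ℝ (Fin N) => |posPartPow N a x|) := by
    have h := (hint.locallyIntegrable).smul_continuous hcont
    refine h.congr (Eventually.of_forall fun x => ?_)
    have : (1 + ‖x‖ ^ ((N : ℝ) + 2 * s)) ≠ 0 := by positivity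
    simp only [smul_eq_mul]
    field_simp
  refine hloc.congr (Eventually.of_forall fun x => ?_)
  exact abs_of_nonneg (posRpow_nonneg _ _)

/-! ### The centered difference -/

/-- The coefficients `(-1)^j binom(2m+2, m+1-j)` of the centered difference of order `2m+2`. -/
noncomputable def diffCoeff (m : ℕ) (j : ℤ) : ℝ :=
  (-1 : ℝ) ^ j * ((2 * m + 2).choose ((m : ℤ) + 1 - j).toNat : ℝ)

/-- The index set `{-m-1, …, m+1}` of the centered difference of order `2m+2`. -/
noncomputable def diffIndex (m : ℕ) : Finset ℤ := Finset.Icc (-((m : ℤ) + 1)) ((m : ℤ) + 1)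

lemma neg_mem_diffIndex {m : ℕ} {j : ℤ} (hj : j ∈ diffIndex m) : -j ∈ diffIndex m := by
  simp only [diffIndex, Finset.mem_Icc] at hj ⊢
  omega

lemma diffCoeff_neg {m : ℕ} {j : ℤ} (hj : j ∈ diffIndex m) : diffCoeff m (-j) = diffCoeff m j := by
  simp only [diffIndex, Finset.mem_Icc] at hj
  simp only [diffCoeff]
  have h1 : (-1 : ℝ) ^ (-j) = (-1) ^ j := by
    rw [zpow_neg, ← inv_zpow]; norm_num
  rw [h1, ← Nat.choose_symm_of_eq_add (a := ((m : ℤ) + 1 - -j).toNat)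
    (b := ((m : ℤ) + 1 - j).toNat) (by omega)]

/-- The centered difference of order `2m+2` annihilates polynomials of degree at most `2m+1`. -/
lemma sum_diffCoeff_mul_pow (m : ℕ) {q : ℕ} (hq : q < 2 * m + 2) :
    ∑ j ∈ diffIndex m, diffCoeff m j * (j : ℝ) ^ q = 0 := by
  have h := congrFun (fwdDiff_iter_pow_eq_zero_of_lt (R := ℝ) hq) (-((m : ℝ) + 1))
  rw [fwdDiff_iter_eq_sum_shift] at h
  simp only [Pi.zero_apply] at h
  -- The centered difference is the forward difference of order 2m+2 started at -(m+1), up to the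
  -- sign (-1)^(m+1).
  rw [← mul_zero ((-1 : ℝ) ^ (m + 1)), ← h, Finset.mul_sum]
  refine Finset.sum_nbij' (fun j : ℤ => (j + (m + 1)).toNat) (fun i : ℕ => (i : ℤ) - (m + 1))
    ?_ ?_ ?_ ?_ ?_
  · intro j hj
    simp only [diffIndex, Finset.mem_Icc, Finset.mem_range] at hj ⊢
    omega
  · intro i hi
    simp only [diffIndex, Finset.mem_Icc, Finset.mem_range] at hi ⊢
    omega
  · intro j hj
    simp only [diffIndex, Finset.mem_Icc] at hj
    omega
  · intro i hi
    omega
  · intro j hj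
    simp only [diffIndex, Finset.mem_Icc] at hj
    obtain ⟨i, hi⟩ : ∃ i : ℕ, j = (i : ℤ) - (m + 1) := ⟨(j + (m + 1)).toNat, by omega⟩
    subst hi
    have hi2 : i ≤ 2 * m + 2 := by omega
    have e1 : ((m : ℤ) + 1 - ((i : ℤ) - (m + 1))).toNat = 2 * m + 2 - i := by omega
    have e2 : ((i : ℤ) - (m + 1) + (m + 1)).toNat = i := by omega
    simp only [diffCoeff, e1, e2]
    rw [Nat.choose_symm hi2]
    have e3 : (-1 : ℝ) ^ ((i : ℤ) - (m + 1)) = (-1) ^ (m + 1) * (-1) ^ (2 * m + 2 - i) := by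
      have hp : (-1 : ℝ) ^ ((i : ℤ) - (m + 1)) = (-1) ^ (i + (m + 1)) := by
        rw [zpow_sub₀ (by norm_num), pow_add, zpow_natCast, div_eq_mul_inv]
        congr 1
        rw [← inv_zpow, show ((-1 : ℝ))⁻¹ = -1 by norm_num]
        exact_mod_cast zpow_natCast (-1 : ℝ) (m + 1)
      rw [hp, ← pow_add]
      apply neg_one_pow_congr
      have : m + 1 + (2 * m + 2 - i) = 3 * (m + 1) - i := by omega
      rw [this]
      have h3 : (Even (3 * (m + 1) - i) ↔ Even (i + (m + 1))) := by
        rw [Nat.even_sub (by omega), Nat.even_add, Nat.even_mul]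
        have : ¬ Even 3 := by decide
        tauto
      exact h3.symm
    rw [e3]
    simp only [nsmul_eq_mul, zsmul_eq_mul, mul_one]
    push_cast
    ring

lemma centeredDiff_eq {N : ℕ} (m : ℕ) (u : EuclideanSpace ℝ (Fin N) → ℝ)
    (x y : EuclideanSpace ℝ (Fin N)) :
    centeredDiff m u x y = ∑ j ∈ diffIndex m, diffCoeff m j * u (x + (j : ℝ) • y) := rfl

lemma sum_diffCoeff_comp_neg (m : ℕ) (f : ℤ → ℝ) :
    ∑ j ∈ diffIndex m, diffCoeff m j * f (-j) = ∑ j ∈ diffIndex m, diffCoeff m j * f j := by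
  refine Finset.sum_nbij' (fun j => -j) (fun j => -j) (fun j => neg_mem_diffIndex)
    (fun j => neg_mem_diffIndex) (by simp) (by simp) fun j hj => ?_
  rw [diffCoeff_neg hj]

lemma dilationSum_abs (m : ℕ) (a t : ℝ) :
    dilationSum (diffIndex m) (diffCoeff m) a |t| = dilationSum (diffIndex m) (diffCoeff m) a t := by
  rcases abs_choice t with h | h <;> rw [h]
  have := sum_diffCoeff_comp_neg m fun j => posRpow a (1 + j * t)
  rw [dilationSum, dilationSum, ← this]
  refine Finset.sum_congr rfl fun j _ => ?_
  push_cast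
  congr 3; ring

/-- Homogeneity of degree a extracts x₁; evenness of the coefficients allows |y₁|, so only the
half-line matters. -/
lemma centeredDiff_posPartPow {N : ℕ} [NeZero N] (m : ℕ) (a : ℝ)
    {x : EuclideanSpace ℝ (Fin N)} (hx : 0 < x 0) (y : EuclideanSpace ℝ (Fin N)) :
    centeredDiff m (posPartPow N a) x y
      = (x 0) ^ a * dilationSum (diffIndex m) (diffCoeff m) a (|y 0| / x 0) := by
  have : |y 0| / x 0 = |y 0 / x 0| := by rw [abs_div, abs_of_pos hx]
  rw [this, dilationSum_abs, centeredDiff_eq, dilationSum, Finset.mul_sum]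
  refine Finset.sum_congr rfl fun j _ => ?_
  rw [posPartPow_eq_posRpow, mul_left_comm, ← posRpow_mul hx]
  congr 2
  simp only [PiLp.add_apply, PiLp.smul_apply, smul_eq_mul]
  field_simp

/-! ### Pointwise harmonicity for σ < 1 -/

lemma integrable_comp_abs {f : ℝ → ℝ} (hf : IntegrableOn f (Ioi 0)) :
    Integrable fun t => f |t| := by
  have hpos : IntegrableOn (fun t => f |t|) (Ioi 0) :=
    hf.congr_fun (fun t ht => by rw [abs_of_pos ht]) measurableSet_Ioi
  have hneg : IntegrableOn (fun t => f |t|) (Iic 0) := by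
    have h := (Measure.measurePreserving_neg (volume : Measure ℝ)).integrableOn_comp_preimage
      (Homeomorph.neg ℝ).measurableEmbedding (f := fun t => f |t|) (s := Ici 0)
    have h2 := h.2 ((integrableOn_Ici_iff_integrableOn_Ioi (by simp)).2 hpos)
    simpa [Function.comp_def] using h2
  have := hneg.union hpos
  rwa [Iic_union_Ioi, integrableOn_univ] at this

lemma integral_fracLaplacianIntegrand_posPartPow (N : ℕ) [NeZero N] (m : ℕ) {σ : ℝ}
    (h0 : 0 < σ) (h1 : σ < 1) (k : ℕ) (hk : k ≤ 2 * m + 1) {x : EuclideanSpace ℝ (Fin N)}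
    (hx : 0 < x 0) :
    Integrable (fracLaplacianIntegrand m σ (posPartPow N ((k : ℝ) + σ - 1)) x) ∧
      ∫ y, fracLaplacianIntegrand m σ (posPartPow N ((k : ℝ) + σ - 1)) x y = 0 := by
  set a : ℝ := (k : ℝ) + σ - 1 with ha
  set q : ℝ := 2 * ((m : ℝ) + σ) with hq
  have hk0 : (0 : ℝ) ≤ k := k.cast_nonneg
  have hk1 : (k : ℝ) ≤ 2 * m + 1 := by exact_mod_cast hk
  have hq0 : 0 < q := by positivity
  set D := dilationSum (diffIndex m) (diffCoeff m) a with hD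
  have hmom : ∀ i < 2 * m + 2, ∑ j ∈ diffIndex m, diffCoeff m j * (j : ℝ) ^ i = 0 :=
    fun i hi => sum_diffCoeff_mul_pow m hi
  have hI : IntegrableOn (fun y => D y * y ^ (-1 - q)) (Ioi 0) :=
    integrableOn_Ioi_zero_dilationSum hmom (by linarith) (by linarith)
      (by push_cast; linarith) (Or.inl hq0)
  have hz : ∫ y in Ioi (0 : ℝ), D y * y ^ (-1 - q) = 0 := by
    -- the coefficients are even on the index set only; extend them by zero
    set c : ℤ → ℝ := fun j => if j ∈ diffIndex m then diffCoeff m j else 0 with hc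
    have hcJ : ∀ j ∈ diffIndex m, c j = diffCoeff m j := fun j hj => if_pos hj
    have h := integral_dilationSum_eq_zero (J := diffIndex m) (c := c) (m := m)
      (fun j => neg_mem_diffIndex) (fun j => by
        by_cases hj : j ∈ diffIndex m
        · rw [hcJ j hj, hcJ _ (neg_mem_diffIndex hj), diffCoeff_neg hj]
        · have hj' : -j ∉ diffIndex m := fun h => hj (by simpa using neg_mem_diffIndex h)
          simp [hc, hj, hj']) h0 h1
      (fun i hi => by
        rw [← hmom i hi]
        exact Finset.sum_congr rfl fun j hj => by rw [hcJ j hj]) k hk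
    have hDc : dilationSum (diffIndex m) c a = D := by
      ext y
      exact Finset.sum_congr rfl fun j hj => by rw [hcJ j hj]
    rw [hDc] at h
    exact h
  set g : ℝ → ℝ := fun t => (x 0) ^ a * D (|t| / x 0) with hg
  have hgm : Measurable g :=
    ((measurable_dilationSum _ _ a).comp (by fun_prop)).const_mul _
  -- Rescaling by x₁ also the power |t|^(-1-q) makes the integrand a dilate of D(y) y^(-1-q).
  set G : ℝ → ℝ := fun t => (x 0) ^ a * (x 0) ^ (-1 - q) * (D ((x 0)⁻¹ * t)
    * ((x 0)⁻¹ * t) ^ (-1 - q)) with hG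
  have hGI : IntegrableOn G (Ioi 0) := by
    refine Integrable.const_mul ?_ _
    have := (integrableOn_Ioi_comp_mul_left_iff (fun t => D t * t ^ (-1 - q)) 0
      (inv_pos.2 hx)).2 (by rw [mul_zero]; exact hI)
    exact this
  have hG0 : ∫ t in Ioi (0 : ℝ), G t = 0 := by
    rw [hG, integral_const_mul, integral_comp_mul_left_Ioi (fun t => D t * t ^ (-1 - q)) 0
      (inv_pos.2 hx), mul_zero, hz]
    simp
  have hgG : (fun t => g t * |t| ^ (-1 - q)) = fun t => G |t| := by
    ext t
    simp only [hg, hG]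
    rw [Real.mul_rpow (inv_nonneg.2 hx.le) (abs_nonneg t), Real.inv_rpow hx.le,
      div_eq_inv_mul]
    have : (x 0) ^ (-1 - q) ≠ 0 := (Real.rpow_pos_of_pos hx _).ne'
    field_simp
  have hcomp : fracLaplacianIntegrand m σ (posPartPow N a) x
      = fun y : EuclideanSpace ℝ (Fin N) => g (y 0) / ‖y‖ ^ ((N : ℝ) + q) := by
    ext y
    rw [fracLaplacianIntegrand, centeredDiff_posPartPow m a hx y]
  have hres := integral_comp_zero_div_norm_rpow N hq0 hgm (by
    rw [hgG]
    exact integrable_comp_abs hGI)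
  rw [hcomp]
  refine ⟨hres.1, hres.2 ?_⟩
  rw [hgG, integral_comp_abs, hG0, mul_zero]

/-! ### Duality with test functions for σ < 1 -/

/-- If the first `Q` moments of `c` vanish, `∑ c_j φ(x + j y) = O(|y|^Q)` uniformly in `x`, for
`φ` smooth with compact support. -/
lemma exists_norm_sum_smul_comp_le.{w} {E F : Type w} [NormedAddCommGroup E] [NormedSpace ℝ E]
    [NormedAddCommGroup F] [NormedSpace ℝ F] (J : Finset ℤ) (Q : ℕ) (c : ℤ → ℝ)
    (hc : ∀ q < Q, ∑ j ∈ J, c j * (j : ℝ) ^ q = 0) {φ : E → F} (hφ : ContDiff ℝ ∞ φ)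
    (hs : HasCompactSupport φ) :
    ∃ C, 0 ≤ C ∧ ∀ x y, ‖∑ j ∈ J, c j • φ (x + (j : ℝ) • y)‖ ≤ C * ‖y‖ ^ Q := by
  -- The derivative takes values in E →L[ℝ] F, so F must vary; the common universe of E and F keeps
  -- this space in it.
  induction Q generalizing c F with
  | zero =>
    obtain ⟨B, hB⟩ := hφ.continuous.bounded_above_of_compact_support hs
    have hB0 : 0 ≤ B := (norm_nonneg _).trans (hB 0)
    refine ⟨∑ j ∈ J, |c j| * B, Finset.sum_nonneg fun _ _ => by positivity, fun x y => ?_⟩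
    rw [pow_zero, mul_one]
    refine (norm_sum_le _ _).trans (Finset.sum_le_sum fun j _ => ?_)
    rw [norm_smul, Real.norm_eq_abs]
    exact mul_le_mul_of_nonneg_left (hB _) (abs_nonneg _)
  | succ Q ih =>
    obtain ⟨C, hC, h⟩ := ih (fun j => c j * j) (fun q hq => by
      rw [← hc (q + 1) (by omega)]
      exact Finset.sum_congr rfl fun j _ => by ring)
      (hφ.fderiv_right (m := ∞) (by simp)) (hs.fderiv ℝ)
    refine ⟨C, hC, fun x y => ?_⟩
    set G : ℝ → F := fun t => ∑ j ∈ J, c j • φ (x + ((j : ℝ) * t) • y) with hG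
    have hd : ∀ t ∈ Icc (0 : ℝ) 1, HasDerivWithinAt G
        ((∑ j ∈ J, (c j * j) • fderiv ℝ φ (x + (j : ℝ) • t • y)) y) (Icc 0 1) t := by
      intro t _
      refine HasDerivAt.hasDerivWithinAt ?_
      rw [sum_apply]
      refine HasDerivAt.fun_sum fun j _ => ?_
      have h1 : HasDerivAt (fun t : ℝ => x + ((j : ℝ) * t) • y) ((j : ℝ) • y) t := by
        simpa using ((((hasDerivAt_id t).const_mul (j : ℝ)).smul_const y).const_add x)
      have h2 : HasFDerivAt φ (fderiv ℝ φ (x + (j : ℝ) • t • y)) (x + ((j : ℝ) * t) • y) := by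
        rw [smul_smul]
        exact (hφ.differentiable (by simp) _).hasFDerivAt
      have h3 := (h2.comp_hasDerivAt t h1).const_smul (c j)
      refine h3.congr_deriv ?_
      simp [smul_smul]
    have hb : ∀ t ∈ Ico (0 : ℝ) 1,
        ‖(∑ j ∈ J, (c j * j) • fderiv ℝ φ (x + (j : ℝ) • t • y)) y‖ ≤ C * ‖y‖ ^ (Q + 1) := by
      intro t ht
      refine (ContinuousLinearMap.le_opNorm _ _).trans ?_
      have hty : ‖t • y‖ ≤ ‖y‖ := by
        rw [norm_smul, Real.norm_of_nonneg ht.1]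
        exact mul_le_of_le_one_left (norm_nonneg _) ht.2.le
      rw [pow_succ, ← mul_assoc]
      refine mul_le_mul_of_nonneg_right ((h x (t • y)).trans ?_) (norm_nonneg _)
      gcongr
    have := norm_image_sub_le_of_norm_deriv_le_segment_01' hd hb
    have hG0 : G 0 = 0 := by
      have h0 : ∑ j ∈ J, c j = 0 := by rw [← hc 0 (by omega)]; simp
      simp only [hG, mul_zero, zero_smul, add_zero]
      rw [← Finset.sum_smul, h0, zero_smul]
    rw [hG0, sub_zero] at this
    simpa [hG] using this

lemma integrable_indicator_norm_rpow_far {N : ℕ} [NeZero N] {q r : ℝ} (hq : 0 < q) (hr : 0 < r) :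
    Integrable fun y : EuclideanSpace ℝ (Fin N) =>
      {y | r < ‖y‖}.indicator (fun y => (‖y‖ ^ ((N : ℝ) + q))⁻¹) y := by
  have e : (fun y : EuclideanSpace ℝ (Fin N) =>
      {y | r < ‖y‖}.indicator (fun y => (‖y‖ ^ ((N : ℝ) + q))⁻¹) y)
      = fun y => (Ioi r).indicator (fun t : ℝ => (t ^ ((N : ℝ) + q))⁻¹) ‖y‖ := by
    ext y; simp [indicator]
  have : Nontrivial (EuclideanSpace ℝ (Fin N)) := inferInstance
  rw [e, integrable_fun_norm_addHaar volume
    (f := (Ioi r).indicator (fun t : ℝ => (t ^ ((N : ℝ) + q))⁻¹)), finrank_euclideanSpace_fin]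
  have h : IntegrableOn ((Ioi r).indicator fun t : ℝ => t ^ (-1 - q)) (Ioi 0) :=
    ((integrableOn_Ioi_rpow_of_lt (by linarith) hr).integrable_indicator
      measurableSet_Ioi).integrableOn
  refine h.congr_fun (fun t ht => ?_) measurableSet_Ioi
  have ht : 0 < t := ht
  by_cases htr : r < t
  · simp only [indicator, mem_Ioi, htr, if_true, smul_eq_mul]
    rw [← Real.rpow_neg ht.le, ← Real.rpow_natCast, ← Real.rpow_add ht,
      Nat.cast_sub NeZero.one_le]
    congr 1; push_cast; ring
  · simp [indicator, htr]

lemma integrable_indicator_norm_rpow_near {N : ℕ} [NeZero N] {q r : ℝ} {Q : ℕ} (hq : q < Q) :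
    Integrable fun y : EuclideanSpace ℝ (Fin N) =>
      {y | ‖y‖ ≤ r}.indicator (fun y => ‖y‖ ^ Q / ‖y‖ ^ ((N : ℝ) + q)) y := by
  have e : (fun y : EuclideanSpace ℝ (Fin N) =>
      {y | ‖y‖ ≤ r}.indicator (fun y => ‖y‖ ^ Q / ‖y‖ ^ ((N : ℝ) + q)) y)
      = fun y => (Iic r).indicator (fun t : ℝ => t ^ Q / t ^ ((N : ℝ) + q)) ‖y‖ := by
    ext y; simp [indicator]
  rw [e, integrable_fun_norm_addHaar volume
    (f := (Iic r).indicator (fun t : ℝ => t ^ Q / t ^ ((N : ℝ) + q))), finrank_euclideanSpace_fin]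
  have h : IntegrableOn ((Ioc 0 r).indicator fun t : ℝ => t ^ (Q - 1 - q)) (Ioi 0) := by
    rcases le_total 0 r with hr | hr
    · have := intervalIntegral.intervalIntegrable_rpow' (a := 0) (b := r) (r := Q - 1 - q)
        (by linarith)
      exact (((intervalIntegrable_iff_integrableOn_Ioc_of_le hr).1 this).integrable_indicator
        measurableSet_Ioc).integrableOn
    · simp [Ioc_eq_empty hr.not_gt]
  refine h.congr_fun (fun t ht => ?_) measurableSet_Ioi
  have ht : 0 < t := ht
  by_cases htr : t ≤ r
  · simp only [indicator, mem_Ioc, mem_Iic, ht, htr, and_self, if_true, smul_eq_mul]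
    rw [div_eq_mul_inv, ← Real.rpow_neg ht.le, ← Real.rpow_natCast, ← Real.rpow_natCast,
      ← Real.rpow_add ht, ← Real.rpow_add ht, Nat.cast_sub NeZero.one_le]
    congr 1; push_cast; ring
  · simp [indicator, htr]

lemma measurePreserving_shear {N : ℕ} (b : ℝ) :
    MeasurePreserving (fun z : EuclideanSpace ℝ (Fin N) × EuclideanSpace ℝ (Fin N) =>
      (z.1 + b • z.2, z.2)) (volume.prod volume) (volume.prod volume) := by
  have h : MeasurePreserving (fun z : EuclideanSpace ℝ (Fin N) × EuclideanSpace ℝ (Fin N) =>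
      (z.1, z.2 + b • z.1)) (volume.prod volume) (volume.prod volume) :=
    (MeasurePreserving.id volume).skew_product (g := fun y x => x + b • y) (by fun_prop)
      (Eventually.of_forall fun y => map_add_right_eq_self volume (b • y))
  exact Measure.measurePreserving_swap.comp (h.comp Measure.measurePreserving_swap)

lemma integrable_mul_of_hasCompactSupport {N : ℕ} {u φ : EuclideanSpace ℝ (Fin N) → ℝ}
    (hu : LocallyIntegrable u) (hφ : Continuous φ) (hs : HasCompactSupport φ) :
    Integrable fun x => φ x * u x :=
  hu.integrable_smul_left_of_hasCompactSupport hφ hs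

/-- For x in the support of φ and |y| > r, 1 + |x + j y|^β ≤ C |y|^β, so the kernel is dominated by
the weight of the space at x + j y. For j = 0 the kernel itself is integrable at infinity. -/
lemma integrableOn_far {N : ℕ} [NeZero N] {s r : ℝ} (hs0 : 0 < s) (hr : 0 < r)
    {u φ : EuclideanSpace ℝ (Fin N) → ℝ} (hum : Measurable u) (hu : MemWeightedL1 s u)
    (hφ : Continuous φ) (hs : HasCompactSupport φ) (j : ℤ) :
    IntegrableOn (fun z : EuclideanSpace ℝ (Fin N) × EuclideanSpace ℝ (Fin N) =>
      φ z.1 * u (z.1 + (j : ℝ) • z.2) / ‖z.2‖ ^ ((N : ℝ) + 2 * s)) {z | r < ‖z.2‖}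
      (volume.prod volume) := by
  have hset : MeasurableSet {z : EuclideanSpace ℝ (Fin N) × EuclideanSpace ℝ (Fin N) |
      r < ‖z.2‖} := measurableSet_lt measurable_const (by fun_prop)
  have hφm := hφ.measurable
  rcases eq_or_ne j 0 with rfl | hj
  · have h := (integrable_mul_of_hasCompactSupport hu.1 hφ hs).mul_prod
      (integrable_indicator_norm_rpow_far (N := N) (q := 2 * s) (by positivity) hr)
    refine h.integrableOn.congr_fun (fun z hz => ?_) hset
    have hz : r < ‖z.2‖ := hz
    simp [indicator, hz, div_eq_mul_inv]
  · have hj' : (j : ℝ) ≠ 0 := by exact_mod_cast hj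
    set β : ℝ := (N : ℝ) + 2 * s with hβ
    have hβ0 : 0 < β := by positivity
    set V : EuclideanSpace ℝ (Fin N) → ℝ := fun x => |u x| / (1 + ‖x‖ ^ β) with hV
    have hVm : Measurable V := by fun_prop
    have hVI : Integrable V := hu.2
    have hV0 : ∀ x, 0 ≤ V x := fun x => by positivity
    have hφI : Integrable φ := hφ.integrable_of_hasCompactSupport hs
    have hPI : Integrable (fun z : EuclideanSpace ℝ (Fin N) × EuclideanSpace ℝ (Fin N) =>
        |φ z.1| * V (z.1 + (j : ℝ) • z.2)) (volume.prod volume) := by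
      rw [integrable_prod_iff (Measurable.aestronglyMeasurable (by fun_prop))]
      have hx : ∀ x : EuclideanSpace ℝ (Fin N), Integrable fun y => V (x + (j : ℝ) • y) :=
        fun x => (hVI.comp_add_left x).comp_smul hj'
      refine ⟨Eventually.of_forall fun x => (hx x).const_mul |φ x|, ?_⟩
      refine (hφI.abs.mul_const (∫ y : EuclideanSpace ℝ (Fin N), V ((j : ℝ) • y))).congr
        (Eventually.of_forall fun x => ?_)
      have e1 : ∀ y, ‖|φ x| * V (x + (j : ℝ) • y)‖ = |φ x| * V (x + (j : ℝ) • y) := fun y =>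
        Real.norm_of_nonneg (mul_nonneg (abs_nonneg _) (hV0 _))
      simp only [e1]
      rw [integral_const_mul, Measure.integral_comp_smul volume V,
        Measure.integral_comp_smul volume (fun y => V (x + y)), integral_add_left_eq_self]
    obtain ⟨R, hR0, hR⟩ : ∃ R : ℝ, 0 ≤ R ∧ ∀ x, φ x ≠ 0 → ‖x‖ ≤ R := by
      obtain ⟨R, hR⟩ := hs.isCompact.isBounded.exists_norm_le
      exact ⟨max R 0, le_max_right _ _, fun x hx =>
        (hR x (subset_tsupport _ hx)).trans (le_max_left _ _)⟩
    set C : ℝ := (r ^ β)⁻¹ + (R / r + |(j : ℝ)|) ^ β with hC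
    refine (hPI.const_mul C).integrableOn.mono'
      (Measurable.aestronglyMeasurable (by fun_prop)) ?_
    refine (ae_restrict_iff' hset).2 (Eventually.of_forall fun z hz => ?_)
    have hz : r < ‖z.2‖ := hz
    have hz0 : 0 < ‖z.2‖ := hr.trans hz
    by_cases hφ0 : φ z.1 = 0
    · simp [hφ0]
    have hzR := hR _ hφ0
    rw [norm_div, norm_mul, Real.norm_eq_abs, Real.norm_eq_abs,
      Real.norm_of_nonneg (Real.rpow_nonneg hz0.le β), hV]
    have key : 1 + ‖z.1 + (j : ℝ) • z.2‖ ^ β ≤ C * ‖z.2‖ ^ β := by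
      have h1 : ‖z.1 + (j : ℝ) • z.2‖ ≤ (R / r + |(j : ℝ)|) * ‖z.2‖ := by
        refine (norm_add_le _ _).trans ?_
        rw [norm_smul, Real.norm_eq_abs, add_mul]
        gcongr
        rw [div_mul_eq_mul_div, le_div_iff₀ hr]
        nlinarith
      have h2 : ‖z.1 + (j : ℝ) • z.2‖ ^ β ≤ (R / r + |(j : ℝ)|) ^ β * ‖z.2‖ ^ β := by
        rw [← Real.mul_rpow (by positivity) hz0.le]
        exact Real.rpow_le_rpow (norm_nonneg _) h1 hβ0.le
      have h3 : 1 ≤ (r ^ β)⁻¹ * ‖z.2‖ ^ β := by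
        rw [inv_mul_eq_div, one_le_div (by positivity)]
        exact Real.rpow_le_rpow hr.le hz.le hβ0.le
      rw [hC, add_mul]; linarith
    have hpos : 0 < 1 + ‖z.1 + (j : ℝ) • z.2‖ ^ β := by positivity
    have hpos2 : 0 < ‖z.2‖ ^ β := by positivity
    rw [← mul_div_assoc, ← mul_div_assoc, div_le_div_iff₀ hpos2 hpos]
    calc |φ z.1| * |u (z.1 + (j : ℝ) • z.2)| * (1 + ‖z.1 + (j : ℝ) • z.2‖ ^ β)
        ≤ |φ z.1| * |u (z.1 + (j : ℝ) • z.2)| * (C * ‖z.2‖ ^ β) := by gcongr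
      _ = C * (|φ z.1| * |u (z.1 + (j : ℝ) • z.2)|) * ‖z.2‖ ^ β := by ring

/-- The shear (x, y) ↦ (x + j y, y) preserves y and volume, and exchanges the roles of u and φ at
the cost of j ↦ -j. -/
lemma integrableOn_far_shear {N : ℕ} [NeZero N] {s r : ℝ} (hs0 : 0 < s) (hr : 0 < r)
    {u φ : EuclideanSpace ℝ (Fin N) → ℝ} (hum : Measurable u) (hu : MemWeightedL1 s u)
    (hφ : Continuous φ) (hs : HasCompactSupport φ) (j : ℤ) :
    IntegrableOn (fun z : EuclideanSpace ℝ (Fin N) × EuclideanSpace ℝ (Fin N) =>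
      u z.1 * φ (z.1 + (j : ℝ) • z.2) / ‖z.2‖ ^ ((N : ℝ) + 2 * s)) {z | r < ‖z.2‖}
      (volume.prod volume) := by
  have hset : MeasurableSet {z : EuclideanSpace ℝ (Fin N) × EuclideanSpace ℝ (Fin N) |
      r < ‖z.2‖} := measurableSet_lt measurable_const (by fun_prop)
  have h := integrableOn_far hs0 hr hum hu hφ hs (-j)
  have h2 := ((measurePreserving_shear (N := N) (j : ℝ)).restrict_preimage
    hset).integrable_comp_of_integrable h
  refine h2.congr (Eventually.of_forall fun z => ?_)
  simp [mul_comm]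

/-- Duality between the finite-difference operators applied to `u` and to a test function. -/
theorem integral_mul_fracLaplacianIntegrand_comm {N : ℕ} [NeZero N] {m : ℕ} {σ : ℝ} (h0 : 0 < σ) (h1 : σ < 1)
    {u φ : EuclideanSpace ℝ (Fin N) → ℝ} (hum : Measurable u) (hu : MemWeightedL1 (m + σ) u)
    (hφ : ContDiff ℝ ∞ φ) (hs : HasCompactSupport φ) {r C : ℝ} (hr : 0 < r)
    (hnear : ∀ x, φ x ≠ 0 → ∀ y, ‖y‖ ≤ r → |centeredDiff m u x y| ≤ C * ‖y‖ ^ (2 * m + 2)) :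
    Integrable (fun x => u x * ∫ y, fracLaplacianIntegrand m σ φ x y) ∧
      ∫ x, u x * ∫ y, fracLaplacianIntegrand m σ φ x y
        = ∫ x, φ x * ∫ y, fracLaplacianIntegrand m σ u x y := by
  have hφc := hφ.continuous
  have hφm := hφc.measurable
  have hs0 : 0 < (m : ℝ) + σ := by positivity
  have hset : MeasurableSet {z : EuclideanSpace ℝ (Fin N) × EuclideanSpace ℝ (Fin N) |
      r < ‖z.2‖} := measurableSet_lt measurable_const (by fun_prop)
  have hset' : MeasurableSet {z : EuclideanSpace ℝ (Fin N) × EuclideanSpace ℝ (Fin N) |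
      ‖z.2‖ ≤ r} := measurableSet_le (by fun_prop) measurable_const
  have hunion : {z : EuclideanSpace ℝ (Fin N) × EuclideanSpace ℝ (Fin N) | ‖z.2‖ ≤ r}
      ∪ {z | r < ‖z.2‖} = univ := by
    ext z; simpa using le_or_gt _ _
  have hnearI := integrable_indicator_norm_rpow_near (N := N) (q := 2 * ((m : ℝ) + σ)) (r := r)
    (Q := 2 * m + 2) (by push_cast; linarith)
  have hmD : ∀ v : EuclideanSpace ℝ (Fin N) → ℝ, Measurable v →
      Measurable fun z : EuclideanSpace ℝ (Fin N) × EuclideanSpace ℝ (Fin N) =>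
        fracLaplacianIntegrand m σ v z.1 z.2 := by
    intro v hv
    simp only [fracLaplacianIntegrand, centeredDiff_eq]
    fun_prop
  -- integrability of `u(x) (D φ)(x, y) / |y|^(N+2s)`
  have hH : Integrable (fun z : EuclideanSpace ℝ (Fin N) × EuclideanSpace ℝ (Fin N) =>
      u z.1 * fracLaplacianIntegrand m σ φ z.1 z.2) (volume.prod volume) := by
    rw [← integrableOn_univ, ← hunion]
    refine IntegrableOn.union ?_ ?_
    · obtain ⟨B, hB0, hB⟩ := exists_norm_sum_smul_comp_le (diffIndex m) (2 * m + 2) (diffCoeff m)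
        (fun q hq => sum_diffCoeff_mul_pow m hq) hφ hs
      obtain ⟨R, hR⟩ := hs.isCompact.isBounded.exists_norm_le
      set M : ℝ := ∑ j ∈ diffIndex m, |(j : ℝ)|
      -- When |y| ≤ r and |x| > R + M r, every x + j y misses the support of φ, so only u on this
      -- ball is seen.
      have huI : Integrable ((Metric.closedBall 0 (R + M * r)).indicator u) :=
        (hu.1.integrableOn_isCompact (isCompact_closedBall _ _)).integrable_indicator
          measurableSet_closedBall
      refine ((huI.norm.mul_prod hnearI).const_mul B).integrableOn.mono'
        ((hum.comp measurable_fst).mul (hmD φ hφm)).aestronglyMeasurable ?_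
      refine (ae_restrict_iff' hset').2 (Eventually.of_forall fun z hz => ?_)
      have hz : ‖z.2‖ ≤ r := hz
      simp only [indicator, mem_ofPred_eq, hz, if_true, fracLaplacianIntegrand]
      have hBz : |centeredDiff m φ z.1 z.2| ≤ B * ‖z.2‖ ^ (2 * m + 2) := hB z.1 z.2
      split_ifs with hball
      · rw [norm_mul, norm_div, Real.norm_eq_abs (centeredDiff _ _ _ _),
          Real.norm_of_nonneg (Real.rpow_nonneg (norm_nonneg _) _)]
        calc _ ≤ ‖u z.1‖ * (B * ‖z.2‖ ^ (2 * m + 2)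
              / ‖z.2‖ ^ ((N : ℝ) + 2 * ((m : ℝ) + σ))) := by gcongr
          _ = _ := by ring
      · have : centeredDiff m φ z.1 z.2 = 0 := by
          rw [centeredDiff_eq]
          refine Finset.sum_eq_zero fun j hj => ?_
          rw [image_eq_zero_of_notMem_tsupport (f := φ), mul_zero]
          intro hmem
          refine hball (mem_closedBall_zero_iff.2 ?_)
          have hjM : |(j : ℝ)| ≤ M := Finset.single_le_sum (f := fun j : ℤ => |(j : ℝ)|)
            (fun _ _ => abs_nonneg _) hj
          calc ‖z.1‖ = ‖(z.1 + (j : ℝ) • z.2) - (j : ℝ) • z.2‖ := by rw [add_sub_cancel_right]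
            _ ≤ ‖z.1 + (j : ℝ) • z.2‖ + ‖(j : ℝ) • z.2‖ := norm_sub_le _ _
            _ ≤ R + M * r := by
              rw [norm_smul, Real.norm_eq_abs]
              exact add_le_add (hR _ hmem) (mul_le_mul hjM hz (norm_nonneg _)
                ((abs_nonneg _).trans hjM))
        simp [this]
    · have h := integrable_finsetSum (diffIndex m) fun j _ =>
        (integrableOn_far_shear hs0 hr hum hu hφc hs j).const_mul (diffCoeff m j)
      refine h.congr (Eventually.of_forall fun z => ?_)
      simp only [fracLaplacianIntegrand, centeredDiff_eq, Finset.sum_div, Finset.mul_sum]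
      exact Finset.sum_congr rfl fun j _ => by ring
  -- integrability of `φ(x) (D u)(x, y) / |y|^(N+2s)`
  have hK : Integrable (fun z : EuclideanSpace ℝ (Fin N) × EuclideanSpace ℝ (Fin N) =>
      φ z.1 * fracLaplacianIntegrand m σ u z.1 z.2) (volume.prod volume) := by
    rw [← integrableOn_univ, ← hunion]
    refine IntegrableOn.union ?_ ?_
    · have hφI : Integrable φ := hφc.integrable_of_hasCompactSupport hs
      refine ((hφI.norm.mul_prod hnearI).const_mul C).integrableOn.mono'
        ((hφm.comp measurable_fst).mul (hmD u hum)).aestronglyMeasurable ?_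
      refine (ae_restrict_iff' hset').2 (Eventually.of_forall fun z hz => ?_)
      have hz : ‖z.2‖ ≤ r := hz
      simp only [indicator, mem_ofPred_eq, hz, if_true, fracLaplacianIntegrand]
      by_cases hφ0 : φ z.1 = 0
      · simp [hφ0]
      have hBz := hnear z.1 hφ0 z.2 hz
      rw [norm_mul, norm_div, Real.norm_eq_abs (centeredDiff _ _ _ _),
        Real.norm_of_nonneg (Real.rpow_nonneg (norm_nonneg _) _)]
      calc _ ≤ ‖φ z.1‖ * (C * ‖z.2‖ ^ (2 * m + 2)
            / ‖z.2‖ ^ ((N : ℝ) + 2 * ((m : ℝ) + σ))) := by gcongr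
        _ = _ := by ring
    · have h := integrable_finsetSum (diffIndex m) fun j _ =>
        (integrableOn_far hs0 hr hum hu hφc hs j).const_mul (diffCoeff m j)
      refine h.congr (Eventually.of_forall fun z => ?_)
      simp only [fracLaplacianIntegrand, centeredDiff_eq, Finset.sum_div, Finset.mul_sum]
      exact Finset.sum_congr rfl fun j _ => by ring
  refine ⟨by simpa only [integral_const_mul] using hH.integral_prod_left, ?_⟩
  -- For fixed y, translating x by j y moves the shift from φ to u with opposite sign, which the
  -- even coefficients absorb.
  have hswap : ∀ y : EuclideanSpace ℝ (Fin N),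
      ∫ x, u x * fracLaplacianIntegrand m σ φ x y
        = ∫ x, φ x * fracLaplacianIntegrand m σ u x y := by
    intro y
    have hterm : ∀ b : ℝ, Integrable fun x => u x * φ (x + b • y) := fun b => by
      have := integrable_mul_of_hasCompactSupport hu.1 (φ := fun x => φ (x + b • y))
        (by fun_prop) (hs.comp_homeomorph (Homeomorph.addRight (b • y)))
      simpa only [mul_comm] using this
    have hterm' : ∀ b : ℝ, Integrable fun x => φ x * u (x + b • y) := fun b => by
      have := (hterm (-b)).comp_add_right (b • y)
      simpa [mul_comm] using this
    have hshift : ∀ b : ℝ, ∫ x, u x * φ (x + b • y) = ∫ x, φ x * u (x + (-b) • y) := fun b => by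
      rw [← integral_add_right_eq_self (μ := volume) (fun x => φ x * u (x + (-b) • y)) (b • y)]
      simp [mul_comm]
    have e1 : ∀ x, u x * fracLaplacianIntegrand m σ φ x y = ∑ j ∈ diffIndex m,
        diffCoeff m j / ‖y‖ ^ ((N : ℝ) + 2 * ((m : ℝ) + σ)) * (u x * φ (x + (j : ℝ) • y)) := by
      intro x
      simp only [fracLaplacianIntegrand, centeredDiff_eq, Finset.sum_div, Finset.mul_sum]
      exact Finset.sum_congr rfl fun j _ => by ring
    have e2 : ∀ x, φ x * fracLaplacianIntegrand m σ u x y = ∑ j ∈ diffIndex m,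
        diffCoeff m j / ‖y‖ ^ ((N : ℝ) + 2 * ((m : ℝ) + σ)) * (φ x * u (x + (j : ℝ) • y)) := by
      intro x
      simp only [fracLaplacianIntegrand, centeredDiff_eq, Finset.sum_div, Finset.mul_sum]
      exact Finset.sum_congr rfl fun j _ => by ring
    simp only [e1, e2]
    rw [integral_finsetSum (diffIndex m) fun j _ => (hterm (j : ℝ)).const_mul _,
      integral_finsetSum (diffIndex m) fun j _ => (hterm' (j : ℝ)).const_mul _]
    simp only [integral_const_mul, hshift]
    simp only [div_mul_eq_mul_div]
    rw [← Finset.sum_div, ← Finset.sum_div]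
    congr 1
    have := sum_diffCoeff_comp_neg m fun j => ∫ x, φ x * u (x + (j : ℝ) • y)
    simpa only [Int.cast_neg] using this
  calc ∫ x, u x * ∫ y, fracLaplacianIntegrand m σ φ x y
      = ∫ x, ∫ y, u x * fracLaplacianIntegrand m σ φ x y := by simp only [integral_const_mul]
    _ = ∫ y, ∫ x, u x * fracLaplacianIntegrand m σ φ x y := integral_integral_swap hH
    _ = ∫ y, ∫ x, φ x * fracLaplacianIntegrand m σ u x y := by simp only [hswap]
    _ = ∫ x, ∫ y, φ x * fracLaplacianIntegrand m σ u x y := (integral_integral_swap hK).symm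
    _ = ∫ x, φ x * ∫ y, fracLaplacianIntegrand m σ u x y := by simp only [integral_const_mul]

lemma exists_abs_centeredDiff_posPartPow_le {N : ℕ} [NeZero N] (m : ℕ) (a : ℝ)
    {K : Set (EuclideanSpace ℝ (Fin N))} (hK : IsCompact K) (hKU : K ⊆ halfSpace N) :
    ∃ r C, 0 < r ∧ ∀ x ∈ K, ∀ y, ‖y‖ ≤ r →
      |centeredDiff m (posPartPow N a) x y| ≤ C * ‖y‖ ^ (2 * m + 2) := by
  obtain ⟨r₀, hr₀, hr⟩ := exists_radius (diffIndex m)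
  obtain ⟨C, hC, hb⟩ := exists_abs_dilationSum_le hr (2 * m + 2) (diffCoeff m) a
    fun q hq => sum_diffCoeff_mul_pow m hq
  have hc0 : Continuous fun x : EuclideanSpace ℝ (Fin N) => x 0 := by fun_prop
  -- On K one has x₁ ≥ δ, so |y| ≤ r₀ δ forces |y₁|/x₁ ≤ r₀.
  obtain ⟨δ, hδ0, hδ⟩ := hK.exists_forall_le' (a := 0) hc0.continuousOn fun x hx => hKU hx
  have hcont : ContinuousOn (fun x : EuclideanSpace ℝ (Fin N) =>
      (x 0) ^ a * (C / (x 0) ^ (2 * m + 2))) K := by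
    refine (hc0.continuousOn.rpow_const fun x hx => Or.inl (hKU hx).ne').mul
      (continuousOn_const.div (hc0.continuousOn.pow _) fun x hx => ?_)
    exact pow_ne_zero _ (hKU hx).ne'
  obtain ⟨B, hB⟩ := hK.exists_bound_of_continuousOn hcont
  refine ⟨r₀ * δ, B, by positivity, fun x hx y hy => ?_⟩
  have hx0 : 0 < x 0 := hKU hx
  have hy0 : |y 0| ≤ ‖y‖ := PiLp.norm_apply_le y 0
  rw [centeredDiff_posPartPow m a hx0 y, abs_mul, abs_of_pos (Real.rpow_pos_of_pos hx0 a)]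
  have h1 : |y 0| / x 0 ≤ r₀ := by
    rw [div_le_iff₀ hx0]
    exact (hy0.trans hy).trans (mul_le_mul_of_nonneg_left (hδ x hx) hr₀.le)
  calc (x 0) ^ a * |dilationSum (diffIndex m) (diffCoeff m) a (|y 0| / x 0)|
      ≤ (x 0) ^ a * (C * (|y 0| / x 0) ^ (2 * m + 2)) := by
        gcongr
        exact hb _ ⟨by positivity, h1⟩
    _ = (x 0) ^ a * (C / (x 0) ^ (2 * m + 2)) * |y 0| ^ (2 * m + 2) := by
        rw [div_pow]; ring
    _ ≤ B * ‖y‖ ^ (2 * m + 2) := by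
        have h2 := (le_abs_self _).trans (hB x hx)
        have h3 : 0 ≤ (x 0) ^ a * (C / (x 0) ^ (2 * m + 2)) := by positivity
        exact mul_le_mul h2 (pow_le_pow_left₀ (abs_nonneg _) hy0 _) (by positivity)
          (h3.trans h2)

lemma isOpen_halfSpace (N : ℕ) [NeZero N] : IsOpen (halfSpace N) :=
  isOpen_lt continuous_const (by fun_prop)

lemma contDiffOn_posPartPow (N : ℕ) [NeZero N] (a : ℝ) :
    ContDiffOn ℝ ∞ (posPartPow N a) (halfSpace N) := by
  have h : ContDiffOn ℝ ∞ (fun x : EuclideanSpace ℝ (Fin N) => (x 0) ^ a) (halfSpace N) :=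
    ContDiffOn.rpow_const_of_ne (ContDiff.contDiffOn (by fun_prop)) fun x hx =>
      (show 0 < x 0 from hx).ne'
  exact h.congr fun x hx => if_pos hx

/-! ### The case σ = 1: iterated Laplacians -/

section Laplacian

open Laplacian

variable {N : ℕ}

local notation "E" => EuclideanSpace ℝ (Fin N)

lemma laplacian_eq_sum_fderiv {f : E → ℝ} (hf : ContDiff ℝ 2 f) (x : E) :
    Δ f x = ∑ i, fderiv ℝ (fun y => fderiv ℝ f y (EuclideanSpace.basisFun (Fin N) ℝ i)) x
      (EuclideanSpace.basisFun (Fin N) ℝ i) := by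
  rw [InnerProductSpace.laplacian_eq_iteratedFDeriv_orthonormalBasis f
    (EuclideanSpace.basisFun (Fin N) ℝ)]
  refine Finset.sum_congr rfl fun i _ => ?_
  rw [iteratedFDeriv_two_apply]
  have hd : DifferentiableAt ℝ (fderiv ℝ f) x :=
    (hf.fderiv_right (m := 1) (by norm_num)).differentiable (by norm_num) x
  rw [fderiv_clm_apply hd (differentiableAt_const _)]
  simp

lemma contDiff_neg_laplacian {f : E → ℝ} (hf : ContDiff ℝ ∞ f) :
    ContDiff ℝ ∞ fun x => -Δ f x := by
  have : (fun x => -Δ f x) = fun x => -∑ i, fderiv ℝ (fun y => fderiv ℝ f y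
      (EuclideanSpace.basisFun (Fin N) ℝ i)) x (EuclideanSpace.basisFun (Fin N) ℝ i) := by
    ext x; rw [laplacian_eq_sum_fderiv (hf.of_le (WithTop.coe_le_coe.2 le_top))]
  rw [this]
  refine (ContDiff.sum fun i _ => ?_).neg
  have h1 : ContDiff ℝ ∞ fun y => fderiv ℝ f y (EuclideanSpace.basisFun (Fin N) ℝ i) :=
    (hf.fderiv_right (m := ∞) (by simp)).clm_apply contDiff_const
  exact (h1.fderiv_right (m := ∞) (by simp)).clm_apply contDiff_const

lemma neg_laplacian_eqOn {f g : E → ℝ} {U : Set E} (hU : IsOpen U) (h : EqOn f g U) :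
    EqOn (fun x => -Δ f x) (fun x => -Δ g x) U := by
  intro x hx
  have := (InnerProductSpace.laplacian_congr_nhds
    (h.eventuallyEq_of_mem (hU.mem_nhds hx))).self_of_nhds
  simp only [this]

lemma neg_laplacian_iterate_eqOn {f g : E → ℝ} {U : Set E} (hU : IsOpen U) (h : EqOn f g U)
    (n : ℕ) : EqOn ((fun v : E → ℝ => fun x => -Δ v x)^[n] f)
      ((fun v : E → ℝ => fun x => -Δ v x)^[n] g) U := by
  induction n with
  | zero => exact h
  | succ n ih =>
    rw [Function.iterate_succ_apply', Function.iterate_succ_apply']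
    exact neg_laplacian_eqOn hU ih

lemma neg_laplacian_iterate_zero (n : ℕ) :
    (fun v : E → ℝ => fun x => -Δ v x)^[n] (fun _ => 0) = fun _ => 0 := by
  refine Function.iterate_fixed ?_ n
  ext x
  rw [InnerProductSpace.laplacian_const]
  simp

lemma neg_laplacian_iterate_eq_zero {φ : E → ℝ} (n : ℕ) {x : E} (hx : x ∉ tsupport φ) :
    (fun v : E → ℝ => fun x => -Δ v x)^[n] φ x = 0 := by
  have h := neg_laplacian_iterate_eqOn (f := φ) (g := fun _ => 0) (U := (tsupport φ)ᶜ)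
    (isClosed_tsupport φ).isOpen_compl (fun y hy => image_eq_zero_of_notMem_tsupport hy) n hx
  rw [h, neg_laplacian_iterate_zero]

lemma contDiff_neg_laplacian_iterate {φ : E → ℝ} (hφ : ContDiff ℝ ∞ φ) (n : ℕ) :
    ContDiff ℝ ∞ ((fun v : E → ℝ => fun x => -Δ v x)^[n] φ) := by
  induction n with
  | zero => exact hφ
  | succ n ih =>
    rw [Function.iterate_succ_apply']
    exact contDiff_neg_laplacian ih

lemma hasCompactSupport_neg_laplacian_iterate {φ : E → ℝ} (hs : HasCompactSupport φ) (n : ℕ) :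
    HasCompactSupport ((fun v : E → ℝ => fun x => -Δ v x)^[n] φ) :=
  hs.mono' fun x hx => by
    by_contra h
    exact hx (neg_laplacian_iterate_eq_zero n h)

/-- Green's second identity against a test function. -/
lemma integral_mul_neg_laplacian {f φ : E → ℝ} (hf : ContDiff ℝ ∞ f) (hφ : ContDiff ℝ ∞ φ)
    (hs : HasCompactSupport φ) : ∫ x, f x * -Δ φ x = ∫ x, -Δ f x * φ x := by
  have hint : ∀ g ψ : E → ℝ, Continuous g → Continuous ψ → HasCompactSupport ψ →
      Integrable fun x => g x * ψ x := fun g ψ hg hψ hsψ =>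
    (hg.mul hψ).integrable_of_hasCompactSupport hsψ.mul_left
  have hD : ∀ (g : E → ℝ) (v : E), ContDiff ℝ ∞ g → ContDiff ℝ ∞ fun y => fderiv ℝ g y v :=
    fun g v hg => (hg.fderiv_right (m := ∞) (by simp)).clm_apply contDiff_const
  have hDs : ∀ (g : E → ℝ) (v : E), HasCompactSupport g →
      HasCompactSupport fun y => fderiv ℝ g y v := fun g v hg => hg.fderiv_apply ℝ v
  have hsecond : ∀ v : E, ∫ x, f x * fderiv ℝ (fun y => fderiv ℝ φ y v) x v
      = ∫ x, fderiv ℝ (fun y => fderiv ℝ f y v) x v * φ x := by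
    intro v
    have hf1 := hD f v hf
    have hφ1 := hD φ v hφ
    have hs1 := hDs φ v hs
    rw [integral_mul_fderiv_eq_neg_fderiv_mul_of_integrable
        (hint _ _ hf1.continuous hφ1.continuous hs1)
        (hint _ _ hf.continuous (hD _ v hφ1).continuous (hDs _ v hs1))
        (hint _ _ hf.continuous hφ1.continuous hs1)
        (fun x _ => hf.differentiable (by simp) x) (fun x _ => hφ1.differentiable (by simp) x),
      integral_mul_fderiv_eq_neg_fderiv_mul_of_integrable
        (hint _ _ (hD _ v hf1).continuous hφ.continuous hs)
        (hint _ _ hf1.continuous hφ1.continuous hs1)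
        (hint _ _ hf1.continuous hφ.continuous hs)
        (fun x _ => hf1.differentiable (by simp) x) (fun x _ => hφ.differentiable (by simp) x), neg_neg]
  have h2 : (2 : WithTop ℕ∞) ≤ ∞ := WithTop.coe_le_coe.2 le_top
  simp only [laplacian_eq_sum_fderiv (hf.of_le h2), laplacian_eq_sum_fderiv (hφ.of_le h2),
    mul_neg, neg_mul, Finset.mul_sum, Finset.sum_mul]
  rw [integral_neg, integral_neg, integral_finsetSum, integral_finsetSum]
  · simp only [hsecond]
  · intro i _
    exact hint _ _ (hD _ _ (hD f _ hf)).continuous hφ.continuous hs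
  · intro i _
    exact hint _ _ hf.continuous (hD _ _ (hD φ _ hφ)).continuous (hDs _ _ (hDs φ _ hs))

variable [NeZero N]

/-- Truncated subtraction is harmless, as the factor k (k - 1) is zero for k < 2. -/
lemma neg_laplacian_const_mul_pow (c : ℝ) (k : ℕ) :
    (fun x : E => -Δ (fun x : E => c * (x 0) ^ k) x)
      = fun x : E => -(c * (k * (k - 1 : ℕ))) * (x 0) ^ (k - 2) := by
  have hd : ∀ (c : ℝ) (k : ℕ) (x v : E), fderiv ℝ (fun x : E => c * (x 0) ^ k) x v
      = c * k * (x 0) ^ (k - 1) * v 0 := by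
    intro c k x v
    have h1 : HasFDerivAt (fun x : E => x 0) (EuclideanSpace.proj (0 : Fin N) : E →L[ℝ] ℝ) x :=
      (EuclideanSpace.proj (0 : Fin N) : E →L[ℝ] ℝ).hasFDerivAt
    rw [((h1.pow k).const_mul c).fderiv]
    simp
    ring
  ext x
  rw [laplacian_eq_sum_fderiv (by fun_prop), Finset.sum_eq_single 0]
  · simp only [hd]
    have : (fun y : E => c * k * (y 0) ^ (k - 1) * (EuclideanSpace.basisFun (Fin N) ℝ 0) 0)
        = fun y : E => (c * k) * (y 0) ^ (k - 1) := by
      ext y; simp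
    have hb : (EuclideanSpace.basisFun (Fin N) ℝ 0) 0 = 1 := by simp
    rw [this, hd, Nat.sub_sub, hb]
    ring
  · intro i _ hi
    rw [show (fun y : E => fderiv ℝ (fun x : E => c * (x 0) ^ k) y
      (EuclideanSpace.basisFun (Fin N) ℝ i)) = fun _ => 0 from ?_]
    · simp
    · ext y
      rw [hd]
      simp [hi.symm]
  · simp

lemma neg_laplacian_iterate_const_mul_pow {n k : ℕ} (hk : k < 2 * n) (c : ℝ) :
    (fun v : E → ℝ => fun x => -Δ v x)^[n] (fun x : E => c * (x 0) ^ k) = fun _ => 0 := by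
  induction n generalizing k c with
  | zero => omega
  | succ n ih =>
    rw [Function.iterate_succ_apply, neg_laplacian_const_mul_pow]
    rcases lt_or_ge k 2 with h | h
    · have : (k : ℝ) * ((k - 1 : ℕ) : ℝ) = 0 := by interval_cases k <;> simp
      simp only [this, mul_zero, neg_zero, zero_mul]
      exact neg_laplacian_iterate_zero n
    · exact ih (by omega) _

/-- Green's identity moves the outermost Laplacian onto the polynomial, lowering its degree by two;
2n exceeds the degree, so it is eventually annihilated. -/
lemma integral_pow_mul_neg_laplacian_iterate {φ : E → ℝ} (hφ : ContDiff ℝ ∞ φ)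
    (hs : HasCompactSupport φ) {n k : ℕ} (hk : k < 2 * n) (c : ℝ) :
    ∫ x : E, c * (x 0) ^ k * (fun v : E → ℝ => fun x => -Δ v x)^[n] φ x = 0 := by
  induction n generalizing k c with
  | zero => omega
  | succ n ih =>
    rw [Function.iterate_succ_apply']
    have h := integral_mul_neg_laplacian (f := fun x : E => c * (x 0) ^ k) (by fun_prop)
      (contDiff_neg_laplacian_iterate hφ n) (hasCompactSupport_neg_laplacian_iterate hs n)
    rw [h]
    have h2 := fun x => congrFun (neg_laplacian_const_mul_pow (N := N) c k) x
    simp only [h2]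
    rcases lt_or_ge k 2 with h | h
    · have : (k : ℝ) * ((k - 1 : ℕ) : ℝ) = 0 := by interval_cases k <;> simp
      simp [this]
    · exact ih (by omega) _

end Laplacian

/-! ### Conclusion -/

theorem proposition1p4 (N : ℕ) [NeZero N] (m : ℕ) (σ : ℝ) (hσ₀ : 0 < σ) (hσ₁ : σ ≤ 1)
    (k : ℕ) (hk : k ≤ 2 * m + 1) :
    ContDiffOn ℝ ∞ (posPartPow N ((k : ℝ) + σ - 1)) (halfSpace N) ∧
      IsPointwiseSHarmonicOn m σ (posPartPow N ((k : ℝ) + σ - 1)) (halfSpace N) ∧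
      IsDistributionallySHarmonicOn m σ (posPartPow N ((k : ℝ) + σ - 1)) (halfSpace N) := by
  have hk0 : (0 : ℝ) ≤ k := k.cast_nonneg
  have hk1 : (k : ℝ) ≤ 2 * m + 1 := by exact_mod_cast hk
  have hL1 : MemWeightedL1 ((m : ℝ) + σ) (posPartPow N ((k : ℝ) + σ - 1)) :=
    memWeightedL1_posPartPow N (by linarith) (by positivity) (by linarith)
  have hsm := contDiffOn_posPartPow N ((k : ℝ) + σ - 1)
  refine ⟨hsm, ⟨hL1, fun x hx => ?_⟩, ⟨hL1, fun φ hφ hs hsupp => ?_⟩⟩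
  · refine ⟨⟨fun _ => ?_, fun hσ => ?_⟩, ?_⟩
    · exact ((hsm x hx).contDiffAt ((isOpen_halfSpace N).mem_nhds hx)).of_le
        (WithTop.coe_le_coe.2 le_top)
    · exact (integral_fracLaplacianIntegrand_posPartPow N m hσ₀ (lt_of_le_of_ne hσ₁ hσ) k hk hx).1
    · by_cases hσ : σ = 1
      · subst hσ
        rw [fracLaplacian, if_pos rfl]
        have h := neg_laplacian_iterate_eqOn (isOpen_halfSpace N)
          (f := posPartPow N ((k : ℝ) + 1 - 1)) (g := fun x => 1 * (x 0) ^ k) (fun y hy => by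
            have hy : 0 < y 0 := hy
            simp [posPartPow, hy]) (m + 1) hx
        rw [h, neg_laplacian_iterate_const_mul_pow (by omega)]
      · rw [fracLaplacian, if_neg hσ, (integral_fracLaplacianIntegrand_posPartPow N m hσ₀
          (lt_of_le_of_ne hσ₁ hσ) k hk hx).2, mul_zero]
  · by_cases hσ : σ = 1
    · subst hσ
      -- Iterated Laplacians of φ vanish off its support, so u may be replaced by the polynomial on
      -- all of space.
      have e : (fun x => posPartPow N ((k : ℝ) + 1 - 1) x * fracLaplacian m 1 φ x)
          = fun x : EuclideanSpace ℝ (Fin N) => 1 * (x 0) ^ k *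
            (fun v : EuclideanSpace ℝ (Fin N) → ℝ => fun x =>
              -Laplacian.laplacian v x)^[m + 1] φ x := by
        ext x
        rw [fracLaplacian, if_pos rfl]
        by_cases hx : x ∈ tsupport φ
        · have hx0 : 0 < x 0 := hsupp hx
          simp [posPartPow, hx0]
        · rw [neg_laplacian_iterate_eq_zero _ hx, mul_zero, mul_zero]
      rw [e]
      refine ⟨?_, integral_pow_mul_neg_laplacian_iterate hφ hs (by omega) 1⟩
      refine Continuous.integrable_of_hasCompactSupport ?_
        (hasCompactSupport_neg_laplacian_iterate hs (m + 1)).mul_left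
      have := (contDiff_neg_laplacian_iterate hφ (m + 1)).continuous
      fun_prop
    · have hσ1 : σ < 1 := lt_of_le_of_ne hσ₁ hσ
      obtain ⟨r, C, hr, hnear⟩ := exists_abs_centeredDiff_posPartPow_le m ((k : ℝ) + σ - 1)
        hs.isCompact hsupp
      obtain ⟨h1, h2⟩ := integral_mul_fracLaplacianIntegrand_comm hσ₀ hσ1
        (measurable_posPartPow N _) hL1 hφ hs hr
        fun x hx y hy => hnear x (subset_tsupport φ hx) y hy
      have e : (fun x => posPartPow N ((k : ℝ) + σ - 1) x * fracLaplacian m σ φ x)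
          = fun x => fracLaplacianConst N m σ / 2 * (posPartPow N ((k : ℝ) + σ - 1) x *
            ∫ y, fracLaplacianIntegrand m σ φ x y) := by
        ext x
        rw [fracLaplacian, if_neg hσ]; ring
      rw [e]
      refine ⟨h1.const_mul _, ?_⟩
      rw [integral_const_mul, h2]
      have hz : ∀ x, φ x * ∫ y, fracLaplacianIntegrand m σ (posPartPow N ((k : ℝ) + σ - 1)) x y
          = 0 := by
        intro x
        by_cases hx : x ∈ tsupport φ
        · rw [(integral_fracLaplacianIntegrand_posPartPow N m hσ₀ hσ1 k hk (hsupp hx)).2, mul_zero]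
        · rw [image_eq_zero_of_notMem_tsupport hx, zero_mul]
      simp only [hz, integral_zero, mul_zero]
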